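/- Let $a\in\mathbb R$, let $d\sigma$ be the uniform probability measure on the unit sphere $\mathbb S^2\subset\mathbb R^3$, and use cylindrical coordinates $(\theta,z)\in[0,2\pi)\times[-1,1]$ on $\mathbb S^2$. For $u\in\mathrm L^2(\mathbb S^2;\mathbb C)$ let $$\nabla_{\mathbf A}u=\left(\sqrt{1-z^2}\,\frac{\partial u}{\partial z},\ \frac1{\sqrt{1-z^2}}\Big(\frac{\partial u}{\partial\theta}-i\,a\,u\Big)\right)$$ in the sense of weak derivatives on $\mathbb S^2$ minus its two poles, and let $\mathrm H^1_{\mathbf A}(\mathbb S^2)$ be the set of all $u\in\mathrm L^2(\mathbb S^2;\mathbb C)$ such that $\nabla_{\mathbf A}u\in\mathrm L^2$. Let $-\Delta_{\mathbf A}$ be the operator in $\mathrm L^2(\mathbb S^2;\mathbb C)$ associated with the Dirichlet form $\int_{\mathbb S^2}|\nabla_{\mathbf A}u|^2\,d\sigma$ on $\mathrm H^1_{\mathbf A}(\mathbb S^2)$. Then $$\int_{\mathbb S^2}|\nabla_{\mathbf A}u|^2\,d\sigma\ \ge\ \Lambda_a\int_{\mathbb S^2}|u|^2\,d\sigma\qquad\forall\,u\in\mathrm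 H^1_{\mathbf A}(\mathbb S^2),\qquad \Lambda_a=\min_{k\in\mathbb Z}|k-a|\,\big(|k-a|+1\big),$$ where the minimum is attained and the constant $\Lambda_a$ is optimal, that is, the largest one for which the inequality holds. Moreover $\Lambda_a$ is the lowest eigenvalue of $-\Delta_{\mathbf A}$, and the spectrum of $-\Delta_{\mathbf A}$ consists of eigenvalues and is equal to $$\big\{(\ell+|k-a|)(\ell+|k-a|+1)\ :\ \ell\in\mathbb N,\ k\in\mathbb Z\big\},\qquad \mathbb N=\{0,1,2,\dots\}.$$ -/

import Mathlib

open MeasureTheory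
open scoped ContDiff

namespace MagneticSphere

/-- The unit sphere `S²` in Euclidean `ℝ³`. -/
abbrev S2 : Type := Metric.sphere (0 : EuclideanSpace ℝ (Fin 3)) 1

/-- The uniform probability measure `dσ` on `S²`: the surface measure induced by the Lebesgue
measure of `ℝ³`, divided by its total mass. -/
noncomputable def sigma : Measure S2 :=
  ((volume : Measure (EuclideanSpace ℝ (Fin 3))).toSphere Set.univ)⁻¹ •
    (volume : Measure (EuclideanSpace ℝ (Fin 3))).toSphere

/-- The complex Hilbert space `L²(S², dσ; ℂ)`. -/
abbrev L2 : Type := Lp ℂ 2 sigma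

theorem cyl_mem (t w : ℝ) (hw : w ∈ Set.Icc (-1 : ℝ) 1) :
    !₂[√(1 - w ^ 2) * Real.cos t, √(1 - w ^ 2) * Real.sin t, w] ∈
      Metric.sphere (0 : EuclideanSpace ℝ (Fin 3)) 1 := by
  have h1 : 0 ≤ 1 - w ^ 2 := by nlinarith [hw.1, hw.2]
  have h2 := Real.sin_sq_add_cos_sq t
  have h3 := Real.sq_sqrt h1
  rw [mem_sphere_zero_iff_norm, EuclideanSpace.norm_eq, Real.sqrt_eq_one]
  simp [Fin.sum_univ_three, mul_pow, h3]
  linear_combination (1 - w ^ 2) * h2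

/-- Cylindrical coordinates `p = (θ, z)` on `S²`: for `z ∈ [-1, 1]` this is the point
`(√(1 - z²) cos θ, √(1 - z²) sin θ, z)`. (For other `z`, which play no role, `z` is
replaced by the nearest point of `[-1, 1]`.) -/
noncomputable def cyl (p : ℝ × ℝ) : S2 :=
  ⟨_, cyl_mem p.1 (Set.projIcc (-1 : ℝ) 1 (by norm_num) p.2)
    (Set.projIcc (-1 : ℝ) 1 (by norm_num) p.2).2⟩

/-- The coordinate rectangle `0 < θ < 2π`, `-1 < z < 1`; its image omits only the poles and one
meridian. -/
def rect : Set (ℝ × ℝ) := Set.Ioo 0 (2 * Real.pi) ×ˢ Set.Ioo (-1) 1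

/-- Smooth compactly supported test functions on `S²` minus its two poles (the set on which the
magnetic potential is smooth), written in the coordinates `(θ, z)`. -/
structure IsTest (φ : ℝ × ℝ → ℂ) : Prop where
  smooth : ContDiff ℝ ∞ φ
  periodic : ∀ t z : ℝ, φ (t + 2 * Real.pi, z) = φ (t, z)
  supp : ∃ r < (1 : ℝ), ∀ t z : ℝ, r < |z| → φ (t, z) = 0

/-- `u ∈ H¹_A(S²)` with magnetic gradient `∇_A u = (g₁, g₂)`, where `g₁, g₂ ∈ L²(S²)` and
`g₁ = √(1 - z²) ∂u/∂z`, `g₂ = (1 / √(1 - z²)) (∂u/∂θ - i a u)` in the sense of weak derivatives.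
Thus `u ∈ H¹_A(S²)` if and only if such `g₁, g₂` exist. -/
structure HasMagneticGradient (a : ℝ) (u g₁ g₂ : L2) : Prop where
  dz : ∀ φ : ℝ × ℝ → ℂ, IsTest φ →
    ∫ p in rect, u (cyl p) * deriv (fun z => φ (p.1, z)) p.2 =
      - ∫ p in rect, g₁ (cyl p) / (√(1 - p.2 ^ 2) : ℝ) * φ p
  dtheta : ∀ φ : ℝ × ℝ → ℂ, IsTest φ →
    ∫ p in rect, u (cyl p) * (deriv (fun t => φ (t, p.2)) p.1 + Complex.I * a * φ p) =
      - ∫ p in rect, (√(1 - p.2 ^ 2) : ℝ) * g₂ (cyl p) * φ p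

/-- The graph of the magnetic Laplacian `-Δ_A`, the operator in `L²(S²)` associated with the
Dirichlet form `∫ |∇_A u|² dσ` on `H¹_A(S²)`: `u` is in its domain and `-Δ_A u = f` if and only
if `u ∈ H¹_A(S²)`, `f ∈ L²(S²)` and `∫ ∇_A u · conj (∇_A v) dσ = ∫ f conj v dσ` for all
`v ∈ H¹_A(S²)`. -/
def IsNegLaplacian (a : ℝ) (u f : L2) : Prop :=
  ∃ g₁ g₂ : L2, HasMagneticGradient a u g₁ g₂ ∧
    ∀ v h₁ h₂ : L2, HasMagneticGradient a v h₁ h₂ →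
      inner ℂ h₁ g₁ + inner ℂ h₂ g₂ = inner ℂ v f

/-- The set of eigenvalues of `-Δ_A`. -/
def eigenvalues (a : ℝ) : Set ℂ :=
  {μ | ∃ u : L2, u ≠ 0 ∧ IsNegLaplacian a u (μ • u)}

/-- The resolvent set of `-Δ_A`: all `μ` for which `-Δ_A - μ` is a bijection of the domain onto
`L²(S²)` with bounded inverse `R`. -/
def resolvents (a : ℝ) : Set ℂ :=
  {μ | ∃ R : L2 →L[ℂ] L2, (∀ g : L2, IsNegLaplacian a (R g) (g + μ • R g)) ∧
    ∀ u f : L2, IsNegLaplacian a u f → R (f - μ • u) = u}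

/-- The spectrum of `-Δ_A`. -/
def laplaceSpectrum (a : ℝ) : Set ℂ := (resolvents a)ᶜ

/-- `Λ_a`, the infimum over `k ∈ ℤ` of `|k - a| (|k - a| + 1)`. -/
noncomputable def groundLevel (a : ℝ) : ℝ :=
  ⨅ k : ℤ, |(k : ℝ) - a| * (|(k : ℝ) - a| + 1)

end MagneticSphere

/-! The proof is separation of variables. In the coordinates (θ, z) the area measure is a multiple
of dθ dz (Archimedes), and on e^{ikθ} F(z) the operator acts as F ↦ -((1 - z²)F')' + (k - a)² F / (1
- z²). With m = |k - a|, the finite-energy solutions are (1 - z²)^{m/2} times a Gegenbauer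
polynomial of degree n, with eigenvalue (n + m)(n + m + 1) (`profile_ode`).

The delicate point is Green's formula (`IsRadial.modePairing_green`): the eigenvalue equation has to
hold against every element of H¹_A, and such an element is known only through test functions
supported away from the poles. Cutoffs χ_n leave a boundary term containing χ_n' (1 - z²) F'. It
vanishes in the limit because χ_n' (1 - z²) is bounded uniformly in n; the remaining integrability
comes from the angular component of the gradient if k ≠ a, and from F' ∈ L² if k = a.

Completeness of the eigenfunctions is Weierstrass approximation in z combined with Fourier
uniqueness in θ (`eq_zero_of_inner_eigenfun`). Orthogonality comes from the angular integral for
distinct k, and from symmetry of the form with distinct eigenvalues for equal k. After normalization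
this gives a Hilbert basis that diagonalizes the form (`exists_isEigenbasis`).

The magnetic gradient has a closed graph, so -Δ_A + 1 is onto by Riesz representation. Hence the
diagonal operator with entries 1 / (λ_j - μ) really maps into the domain and is the resolvent
whenever μ is not a level. The inequality is Bessel's inequality for the eigenfunctions in the graph
norm; a lowest eigenfunction shows that the constant is sharp. -/

namespace MagneticSphere

/-! ### Cylindrical coordinates and the area measure -/

theorem cyl_val {p : ℝ × ℝ} (hp : p.2 ∈ Set.Ioo (-1 : ℝ) 1) :
    (cyl p : EuclideanSpace ℝ (Fin 3)) =
      !₂[√(1 - p.2 ^ 2) * Real.cos p.1, √(1 - p.2 ^ 2) * Real.sin p.1, p.2] := by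
  simp only [cyl, Set.projIcc_of_mem _ (Set.Ioo_subset_Icc_self hp)]

theorem continuous_cyl : Continuous cyl := by
  unfold cyl
  refine Continuous.subtype_mk ?_ _
  refine (PiLp.continuous_toLp 2 _).comp (continuous_pi fun i => ?_)
  have h : Continuous fun p : ℝ × ℝ =>
      ((Set.projIcc (-1 : ℝ) 1 (by norm_num) p.2 : Set.Icc (-1 : ℝ) 1) : ℝ) :=
    continuous_subtype_val.comp (continuous_projIcc.comp continuous_snd)
  fin_cases i <;> simp <;> fun_prop

theorem measurable_cyl : Measurable cyl := continuous_cyl.measurable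

theorem measurableSet_rect : MeasurableSet rect := measurableSet_Ioo.prod measurableSet_Ioo

theorem volume_rect : volume rect = ENNReal.ofReal (4 * Real.pi) := by
  rw [rect, Measure.volume_eq_prod, Measure.prod_prod, Real.volume_Ioo, Real.volume_Ioo,
    ← ENNReal.ofReal_mul (by linarith [Real.pi_pos])]
  ring_nf

theorem sphere_sq_sum (x : S2) : x.1 0 ^ 2 + x.1 1 ^ 2 + x.1 2 ^ 2 = 1 := by
  have h := x.2
  rw [mem_sphere_zero_iff_norm, EuclideanSpace.norm_eq, Real.sqrt_eq_one] at h
  simpa [Fin.sum_univ_three] using h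

/-- Every point of the sphere off the plane `x₁ = 0` has cylindrical coordinates in `rect`. -/
theorem exists_cyl_eq (x : S2) (hx : x.1 1 ≠ 0) : ∃ p ∈ rect, cyl p = x := by
  have hs := sphere_sq_sum x
  have h1 : 0 < x.1 1 ^ 2 := by positivity
  have hz : x.1 2 ∈ Set.Ioo (-1 : ℝ) 1 := by
    constructor <;> nlinarith [sq_nonneg (x.1 0)]
  set c : ℂ := ⟨x.1 0, x.1 1⟩ with hc
  have hn : ‖c‖ = √(1 - x.1 2 ^ 2) := by
    rw [Complex.norm_def, Complex.normSq_mk]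
    congr 1
    linarith
  have hcos := Complex.norm_mul_cos_arg c
  have hsin := Complex.norm_mul_sin_arg c
  rw [hn] at hcos hsin
  have key : ∀ t : ℝ, Real.cos t = Real.cos c.arg → Real.sin t = Real.sin c.arg →
      cyl (t, x.1 2) = x := by
    intro t ht ht'
    apply Subtype.ext
    rw [cyl_val hz]
    ext i
    fin_cases i
    · simpa [ht] using hcos
    · simpa [ht'] using hsin
    · simp
  have h0 : c.arg ≠ 0 := by
    intro h
    rw [h, Real.sin_zero, mul_zero] at hsin
    exact hx hsin.symm
  rcases lt_or_gt_of_ne h0 with h | h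
  · refine ⟨(c.arg + 2 * Real.pi, x.1 2), ⟨⟨?_, ?_⟩, hz⟩, key _ ?_ ?_⟩
    · have := Complex.neg_pi_lt_arg c
      simp only; linarith [Real.pi_pos]
    · simp only; linarith
    · simp
    · simp
  · refine ⟨(c.arg, x.1 2), ⟨⟨h, ?_⟩, hz⟩, key _ rfl rfl⟩
    have := Complex.arg_le_pi c
    simp only; linarith [Real.pi_pos]

/-- Spherical coordinates `(r, θ, w) ↦ r • cyl (θ, w)` on `ℝ³`. -/
noncomputable def coneMap (q : Fin 3 → ℝ) : Fin 3 → ℝ :=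
  ![q 0 * (√(1 - q 2 ^ 2) * Real.cos (q 1)), q 0 * (√(1 - q 2 ^ 2) * Real.sin (q 1)), q 0 * q 2]

/-- The Jacobian matrix of `coneMap`. -/
noncomputable def coneJac (q : Fin 3 → ℝ) : Matrix (Fin 3) (Fin 3) ℝ :=
  !![√(1 - q 2 ^ 2) * Real.cos (q 1), -(q 0 * √(1 - q 2 ^ 2) * Real.sin (q 1)),
      -(q 0 * (q 2 / √(1 - q 2 ^ 2)) * Real.cos (q 1));
    √(1 - q 2 ^ 2) * Real.sin (q 1), q 0 * √(1 - q 2 ^ 2) * Real.cos (q 1),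
      -(q 0 * (q 2 / √(1 - q 2 ^ 2)) * Real.sin (q 1));
    q 2, 0, q 0]

/-- The Jacobian does not depend on θ or z: the shrinking of the parallels near the poles exactly
compensates the tilt of the surface. This is the content of Archimedes' theorem. -/
theorem det_coneJac (q : Fin 3 → ℝ) (hq : q 2 ∈ Set.Ioo (-1 : ℝ) 1) :
    (coneJac q).det = q 0 ^ 2 := by
  have h1 : 0 < 1 - q 2 ^ 2 := by nlinarith [hq.1, hq.2]
  have h2 : 0 < √(1 - q 2 ^ 2) := Real.sqrt_pos.2 h1
  have h3 := Real.sq_sqrt h1.le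
  have h4 := Real.sin_sq_add_cos_sq (q 1)
  rw [coneJac, Matrix.det_fin_three]
  simp
  field_simp
  generalize √(1 - q 2 ^ 2) = s at *
  linear_combination q 0 ^ 2 * (q 2 ^ 2 + s ^ 2) * h4 + q 0 ^ 2 * h3

theorem hasFDerivAt_coneMap (q : Fin 3 → ℝ) (hq : q 2 ∈ Set.Ioo (-1 : ℝ) 1) :
    HasFDerivAt coneMap (Matrix.toLin' (coneJac q)).toContinuousLinearMap q := by
  have h1 : 0 < 1 - q 2 ^ 2 := by nlinarith [hq.1, hq.2]
  have e : ∀ i : Fin 3, HasFDerivAt (fun q : Fin 3 → ℝ => q i)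
      (ContinuousLinearMap.proj (R := ℝ) (φ := fun _ : Fin 3 => ℝ) i) q :=
    fun i => hasFDerivAt_apply i q
  have es : HasFDerivAt (fun q : Fin 3 → ℝ => √(1 - q 2 ^ 2)) _ q :=
    (((e 2).pow 2).const_sub 1).sqrt h1.ne'
  have ec := (e 1).cos
  have esn := (e 1).sin
  rw [hasFDerivAt_pi']
  intro i
  fin_cases i
  · refine ((e 0).mul (es.mul ec)).congr_fderiv ?_
    ext j
    simp [coneJac, dotProduct, Fin.sum_univ_three]
    field_simp
    ring
  · refine ((e 0).mul (es.mul esn)).congr_fderiv ?_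
    ext j
    simp [coneJac, dotProduct, Fin.sum_univ_three]
    field_simp
    ring
  · refine ((e 0).mul (e 2)).congr_fderiv ?_
    ext j
    simp [coneJac, dotProduct, Fin.sum_univ_three]
    ring

/-- The parameter set of the cone over `cyl '' A`. -/
def coneDomain (A : Set (ℝ × ℝ)) : Set (Fin 3 → ℝ) :=
  {q | q 0 ∈ Set.Ioo (0 : ℝ) 1 ∧ (q 1, q 2) ∈ A}

/-- The Euclidean norm recovers r, the third coordinate then recovers the height, and the angle is
determined because two angles in (0, 2π) differ by less than 2π. -/
theorem injOn_coneMap : Set.InjOn coneMap (coneDomain rect) := by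
  rintro q ⟨⟨hr, -⟩, ⟨ht0, ht1⟩, hz⟩ q' ⟨⟨hr', -⟩, ⟨ht0', ht1'⟩, hz'⟩ h
  simp only at ht0 ht1 ht0' ht1' hz hz'
  have e0 := congrFun h 0
  have e1 := congrFun h 1
  have e2 := congrFun h 2
  simp only [coneMap, Matrix.cons_val_zero, Matrix.cons_val_one, Matrix.cons_val] at e0 e1 e2
  have a1 : 0 < 1 - q 2 ^ 2 := by nlinarith [hz.1, hz.2]
  have a1' : 0 < 1 - q' 2 ^ 2 := by nlinarith [hz'.1, hz'.2]
  have b := Real.sq_sqrt a1.le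
  have b' := Real.sq_sqrt a1'.le
  have s := Real.sin_sq_add_cos_sq (q 1)
  have s' := Real.sin_sq_add_cos_sq (q' 1)
  have sp := Real.sqrt_pos.2 a1
  have hr2 : q 0 ^ 2 = q' 0 ^ 2 := by
    have n1 : (q 0 * (√(1 - q 2 ^ 2) * Real.cos (q 1))) ^ 2 +
        (q 0 * (√(1 - q 2 ^ 2) * Real.sin (q 1))) ^ 2 + (q 0 * q 2) ^ 2 = q 0 ^ 2 := by
      linear_combination q 0 ^ 2 * √(1 - q 2 ^ 2) ^ 2 * s + q 0 ^ 2 * b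
    have n2 : (q' 0 * (√(1 - q' 2 ^ 2) * Real.cos (q' 1))) ^ 2 +
        (q' 0 * (√(1 - q' 2 ^ 2) * Real.sin (q' 1))) ^ 2 + (q' 0 * q' 2) ^ 2 = q' 0 ^ 2 := by
      linear_combination q' 0 ^ 2 * √(1 - q' 2 ^ 2) ^ 2 * s' + q' 0 ^ 2 * b'
    rw [← n1, ← n2, e0, e1, e2]
  have hrr : q 0 = q' 0 := (sq_eq_sq₀ hr.le hr'.le).1 hr2
  rw [← hrr] at e0 e1 e2
  have hzz := mul_left_cancel₀ hr.ne' e2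
  rw [← hzz] at e0 e1
  have c := mul_left_cancel₀ sp.ne' (mul_left_cancel₀ hr.ne' e0)
  have d := mul_left_cancel₀ sp.ne' (mul_left_cancel₀ hr.ne' e1)
  have hcos : Real.cos (q 1 - q' 1) = 1 := by
    rw [Real.cos_sub, c, d]; linarith
  have htt := (Real.cos_eq_one_iff_of_lt_of_lt (by linarith) (by linarith)).1 hcos
  ext i
  fin_cases i
  · exact hrr
  · simp only [Fin.mk_one]; linarith
  · exact hzz

theorem coneDomain_mono {A B : Set (ℝ × ℝ)} (h : A ⊆ B) : coneDomain A ⊆ coneDomain B :=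
  fun _ hq => ⟨hq.1, h hq.2⟩

/-- The factor 1/3 is ∫₀¹ r² dr. -/
theorem lintegral_coneDomain {A : Set (ℝ × ℝ)} (hA : MeasurableSet A) :
    ∫⁻ q in coneDomain A, ENNReal.ofReal (q 0 ^ 2) = ENNReal.ofReal (1 / 3) * volume A := by
  have hmp : MeasurePreserving (fun q : Fin 3 → ℝ => (q 0, (q 1, q 2))) volume volume :=
    ((MeasurePreserving.id volume).prod (volume_preserving_finTwoArrow ℝ)).comp
      (volume_preserving_piFinSuccAbove (fun _ : Fin 3 => ℝ) 0)
  have h := hmp.setLIntegral_comp_preimage (measurableSet_Ioo.prod hA : MeasurableSet (Set.Ioo (0 : ℝ) 1 ×ˢ A))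
    (f := fun p => ENNReal.ofReal (p.1 ^ 2)) (by fun_prop)
  rw [show coneDomain A = (fun q : Fin 3 → ℝ => (q 0, (q 1, q 2))) ⁻¹' (Set.Ioo (0 : ℝ) 1 ×ˢ A) from rfl,
    h, Measure.volume_eq_prod, setLIntegral_prod _ (by fun_prop)]
  simp only [lintegral_const, Measure.restrict_apply_univ]
  rw [lintegral_mul_const _ (by fun_prop), ← ofReal_integral_eq_lintegral_ofReal]
  · rw [← integral_Ioc_eq_integral_Ioo, ← intervalIntegral.integral_of_le zero_le_one, integral_pow]
    norm_num
  · exact (ContinuousOn.integrableOn_Icc (by fun_prop)).mono_set Set.Ioo_subset_Icc_self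
  · exact .of_forall fun x => sq_nonneg x

theorem measurableSet_coneDomain {A : Set (ℝ × ℝ)} (hA : MeasurableSet A) :
    MeasurableSet (coneDomain A) :=
  (measurable_pi_apply 0 measurableSet_Ioo).inter
    (((measurable_pi_apply 1).prodMk (measurable_pi_apply 2)) hA)

theorem volume_coneMap_image {A : Set (ℝ × ℝ)} (hA : MeasurableSet A) (hAr : A ⊆ rect) :
    volume (coneMap '' coneDomain A) = ENNReal.ofReal (1 / 3) * volume A := by
  rw [← lintegral_coneDomain hA, ← lintegral_abs_det_fderiv_eq_addHaar_image volume
    (measurableSet_coneDomain hA) (fun q hq =>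
      (hasFDerivAt_coneMap q (hAr hq.2).2).hasFDerivWithinAt)
    (injOn_coneMap.mono (coneDomain_mono hAr))]
  refine setLIntegral_congr_fun (measurableSet_coneDomain hA) fun q hq => ?_
  have : ((Matrix.toLin' (coneJac q)).toContinuousLinearMap).det = q 0 ^ 2 := by
    rw [← det_coneJac q (hAr hq.2).2, ← LinearMap.det_toLin']; rfl
  simp only [this, abs_of_nonneg (sq_nonneg (q 0))]

theorem coneMap_eq_smul {q : Fin 3 → ℝ} (hq : q 2 ∈ Set.Ioo (-1 : ℝ) 1) :
    coneMap q = WithLp.ofLp (q 0 • (cyl (q 1, q 2) : EuclideanSpace ℝ (Fin 3))) := by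
  rw [cyl_val hq]
  ext i
  fin_cases i <;> simp [coneMap]

open scoped Pointwise in
/-- Archimedes' hat-box theorem for the surface measure. -/
theorem toSphere_apply_eq_volume {s : Set S2} (hs : MeasurableSet s) :
    (volume : Measure (EuclideanSpace ℝ (Fin 3))).toSphere s = volume (rect ∩ cyl ⁻¹' s) := by
  have hA : MeasurableSet (rect ∩ cyl ⁻¹' s) := measurableSet_rect.inter (measurable_cyl hs)
  rw [Measure.toSphere_apply' _ hs, finrank_euclideanSpace_fin]
  have hmp := PiLp.volume_preserving_toLp (Fin 3)
  have hv : volume (Set.Ioo (0 : ℝ) 1 • ((Subtype.val : S2 → _) '' s)) =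
      volume (coneMap '' coneDomain (rect ∩ cyl ⁻¹' s)) := by
    rw [← hmp.measure_preimage_equiv (f := (MeasurableEquiv.toLp 2 (Fin 3 → ℝ)))]
    apply le_antisymm
    -- The parametrization misses only points of the plane x₁ = 0, which contains the cone over the
    -- poles and the omitted meridian.
    · have hn : volume {f : Fin 3 → ℝ | f 1 = 0} = 0 := by
        rw [volume_pi]; exact Measure.pi_hyperplane _ 1 0
      refine (measure_mono (t := coneMap '' coneDomain (rect ∩ cyl ⁻¹' s) ∪ {f | f 1 = 0})
        ?_).trans ((measure_union_le _ _).trans (by rw [hn, add_zero]))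
      rintro y ⟨r, hr, _, ⟨x, hx, rfl⟩, hy⟩
      by_cases h1 : y 1 = 0
      · exact Or.inr h1
      left
      have hy' : y = WithLp.ofLp (r • (x : EuclideanSpace ℝ (Fin 3))) :=
        (congrArg WithLp.ofLp hy).symm
      obtain ⟨p, hp, rfl⟩ := exists_cyl_eq x (by
        intro h0; apply h1; rw [hy']; simp [h0])
      refine ⟨![r, p.1, p.2], ⟨by simpa using hr, by simpa using ⟨hp, hx⟩⟩, ?_⟩
      rw [coneMap_eq_smul (by simpa using hp.2), hy']
      simp
    · apply measure_mono
      rintro _ ⟨q, hq, rfl⟩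
      refine ⟨q 0, hq.1, _, ⟨cyl (q 1, q 2), hq.2.2, rfl⟩, ?_⟩
      rw [coneMap_eq_smul hq.2.1.2]
      rfl
  -- The dimension factor 3 in the definition of `toSphere` cancels the radial integral 1/3.
  rw [hv, volume_coneMap_image hA Set.inter_subset_left, ← mul_assoc, one_div,
    ENNReal.ofReal_inv_of_pos (by norm_num)]
  rw [show ((3 : ℕ) : ENNReal) = ENNReal.ofReal 3 by simp, ENNReal.mul_inv_cancel (by simp) (by simp),
    one_mul]

/-- Normalized coordinate measure on the rectangle. -/
noncomputable def rectMeasure : Measure (ℝ × ℝ) :=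
  (ENNReal.ofReal (4 * Real.pi))⁻¹ • volume.restrict rect

/-- The whole sphere, as a special case of the hat-box theorem, has mass 4π, so both normalizations
agree. Every L² statement on the sphere is transported to the rectangle through this map. -/
theorem measurePreserving_cyl : MeasurePreserving cyl rectMeasure sigma := by
  refine ⟨measurable_cyl, ?_⟩
  ext s hs
  rw [Measure.map_apply measurable_cyl hs, rectMeasure, sigma, Measure.smul_apply,
    Measure.smul_apply, toSphere_apply_eq_volume hs, toSphere_apply_eq_volume MeasurableSet.univ,
    Measure.restrict_apply (measurable_cyl hs), Set.preimage_univ, Set.inter_univ, volume_rect,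
    Set.inter_comm]

/-! ### Transfer of L² from the sphere to the rectangle -/

/-- Lebesgue measure on the axis `-1 < z < 1`. -/
noncomputable abbrev axisVol : Measure ℝ := volume.restrict (Set.Ioo (-1) 1)

/-- Lebesgue measure on the coordinate rectangle. -/
noncomputable abbrev rectVol : Measure (ℝ × ℝ) := volume.restrict rect

theorem rectVol_eq_prod :
    rectVol = (volume.restrict (Set.Ioo 0 (2 * Real.pi))).prod axisVol := by
  rw [Measure.prod_restrict]; rfl

instance : IsFiniteMeasure rectVol := by
  rw [rectVol_eq_prod]; infer_instance

theorem ofReal_four_pi_ne_zero : ENNReal.ofReal (4 * Real.pi) ≠ 0 := by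
  simp [Real.pi_pos]

theorem rectVol_eq_smul : rectVol = ENNReal.ofReal (4 * Real.pi) • rectMeasure := by
  rw [rectMeasure, smul_smul, ENNReal.mul_inv_cancel ofReal_four_pi_ne_zero ENNReal.ofReal_ne_top,
    one_smul]

theorem ae_rectVol_of_ae_rectMeasure {P : ℝ × ℝ → Prop} (h : ∀ᵐ p ∂rectMeasure, P p) :
    ∀ᵐ p ∂rectVol, P p := by
  rw [rectVol_eq_smul]
  exact Measure.ae_smul_measure h _

theorem comp_cyl_ae_eq {f g : S2 → ℂ} (h : f =ᵐ[sigma] g) :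
    (fun p => f (cyl p)) =ᵐ[rectVol] fun p => g (cyl p) :=
  ae_rectVol_of_ae_rectMeasure (measurePreserving_cyl.quasiMeasurePreserving.ae_eq_comp h)

theorem memLp_rectMeasure_iff {f : ℝ × ℝ → ℂ} : MemLp f 2 rectMeasure ↔ MemLp f 2 rectVol := by
  constructor
  · intro h
    rw [rectVol_eq_smul]
    exact h.smul_measure ENNReal.ofReal_ne_top
  · intro h
    exact h.smul_measure (ENNReal.inv_ne_top.2 ofReal_four_pi_ne_zero)

theorem memLp_comp_cyl (u : L2) : MemLp (fun p => u (cyl p)) 2 rectVol :=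
  memLp_rectMeasure_iff.1 ((Lp.memLp u).comp_measurePreserving measurePreserving_cyl)

theorem integral_rectMeasure (f : ℝ × ℝ → ℂ) :
    ∫ p, f p ∂rectMeasure = (4 * Real.pi : ℂ)⁻¹ * ∫ p in rect, f p := by
  rw [rectMeasure, integral_smul_measure, ENNReal.toReal_inv,
    ENNReal.toReal_ofReal (by positivity), Complex.real_smul]
  push_cast
  rfl

theorem integral_sigma {f : S2 → ℂ} (hf : AEStronglyMeasurable f sigma) :
    ∫ x, f x ∂sigma = ∫ p, f (cyl p) ∂rectMeasure := by
  have h := integral_map (μ := rectMeasure) measurable_cyl.aemeasurable (f := f)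
    (by rwa [measurePreserving_cyl.map_eq])
  rwa [measurePreserving_cyl.map_eq] at h

theorem inner_eq_integral_rect (u v : L2) :
    inner ℂ u v = (4 * Real.pi : ℂ)⁻¹ *
      ∫ p in rect, v (cyl p) * (starRingEnd ℂ) (u (cyl p)) := by
  rw [L2.inner_def, integral_sigma
    ((Lp.aestronglyMeasurable u).inner (Lp.aestronglyMeasurable v)), integral_rectMeasure]
  rfl

/-- Pull-back of functions on the sphere to the coordinate rectangle. -/
noncomputable def pullback : L2 →ₗᵢ[ℂ] Lp ℂ 2 rectMeasure :=
  Lp.compMeasurePreservingₗᵢ ℂ cyl measurePreserving_cyl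

theorem pullback_ae_eq (u : L2) : pullback u =ᵐ[rectMeasure] fun p => u (cyl p) :=
  Lp.coeFn_compMeasurePreserving u measurePreserving_cyl

/-- Integration over the rectangle against a square integrable function is a continuous linear
functional of `u ∈ L²(S²)`. -/
theorem exists_clm_integral_rect {ψ : ℝ × ℝ → ℂ} (hψ : MemLp ψ 2 rectVol) :
    ∃ T : L2 →L[ℂ] ℂ, ∀ u : L2, T u = ∫ p in rect, u (cyl p) * ψ p := by
  have hs : MemLp (star ψ) 2 rectMeasure := memLp_rectMeasure_iff.2 hψ.star
  refine ⟨(4 * Real.pi : ℂ) • (innerSL ℂ (hs.toLp)).comp pullback.toContinuousLinearMap,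
    fun u => ?_⟩
  have h : inner ℂ (hs.toLp) (pullback u) = ∫ p, u (cyl p) * ψ p ∂rectMeasure := by
    rw [L2.inner_def]
    refine integral_congr_ae ?_
    filter_upwards [pullback_ae_eq u, hs.coeFn_toLp] with p h1 h2
    rw [h1, h2]
    simp
  have hpi : (4 * Real.pi : ℂ) ≠ 0 := by
    exact_mod_cast (by positivity : (4 * Real.pi : ℝ) ≠ 0)
  change (4 * Real.pi : ℂ) * inner ℂ (hs.toLp) (pullback u) = _
  rw [h, integral_rectMeasure, mul_inv_cancel_left₀ hpi]

theorem eq_zero_of_comp_cyl {u : L2} (h : ∀ᵐ p ∂rectVol, u (cyl p) = 0) : u = 0 := by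
  have h' : ∀ᵐ p ∂rectMeasure, u (cyl p) = 0 := Measure.ae_smul_measure h _
  apply pullback.injective
  rw [map_zero]
  apply Lp.ext
  filter_upwards [pullback_ae_eq u, h', Lp.coeFn_zero ℂ 2 rectMeasure] with p h1 h2 h3
  rw [h1, h2, h3]; rfl

theorem continuous_memLp_rectVol {ψ : ℝ × ℝ → ℂ} (hψ : Continuous ψ) : MemLp ψ 2 rectVol := by
  obtain ⟨C, hC⟩ := ((isCompact_Icc (a := 0) (b := 2 * Real.pi)).prod
    (isCompact_Icc (a := (-1 : ℝ)) (b := 1))).exists_bound_of_continuousOn hψ.continuousOn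
  refine MemLp.of_bound hψ.aestronglyMeasurable C ?_
  filter_upwards [ae_restrict_mem measurableSet_rect] with p hp
  exact hC p ⟨Set.Ioo_subset_Icc_self hp.1, Set.Ioo_subset_Icc_self hp.2⟩

/-! ### Separated functions and their pairings -/

/-- The function `e^{ikθ} f(z)` on the sphere. -/
noncomputable def mode (k : ℤ) (f : ℝ → ℝ) (x : S2) : ℂ :=
  (((x.1 0 : ℂ) + x.1 1 * Complex.I) / (√(1 - x.1 2 ^ 2) : ℝ)) ^ k * (f (x.1 2) : ℂ)

theorem mode_cyl (k : ℤ) (f : ℝ → ℝ) {p : ℝ × ℝ} (hp : p.2 ∈ Set.Ioo (-1 : ℝ) 1) :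
    mode k f (cyl p) = Complex.exp (k * p.1 * Complex.I) * (f p.2 : ℂ) := by
  have h1 : 0 < √(1 - p.2 ^ 2) := Real.sqrt_pos.2 (by nlinarith [hp.1, hp.2])
  have h2 : ((√(1 - p.2 ^ 2) : ℝ) : ℂ) ≠ 0 := by exact_mod_cast h1.ne'
  rw [mode, cyl_val hp]
  simp only [Matrix.cons_val_zero, Matrix.cons_val_one, Matrix.cons_val]
  congr 1
  rw [mul_assoc, Complex.exp_int_mul, Complex.exp_mul_I]
  congr 1
  push_cast
  field_simp

theorem measurable_mode (k : ℤ) {f : ℝ → ℝ} (hf : Measurable f) : Measurable (mode k f) := by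
  have h : ∀ i : Fin 3, Measurable fun x : S2 => x.1 i := fun i =>
    ((EuclideanSpace.proj (𝕜 := ℝ) i).continuous.comp continuous_subtype_val).measurable
  have h0 := h 0
  have h1 := h 1
  have h2 := h 2
  unfold mode
  refine Measurable.mul ?_ (Complex.measurable_ofReal.comp (hf.comp h2))
  refine Measurable.pow_const ?_ k
  fun_prop

theorem norm_exp_int_mul_I (k : ℤ) (t : ℝ) : ‖Complex.exp (k * t * Complex.I)‖ = 1 := by
  have := Complex.norm_exp_ofReal_mul_I (k * t)
  push_cast at this
  exact this

theorem norm_exp_neg_int_mul_I (k : ℤ) (t : ℝ) : ‖Complex.exp (-(k * t * Complex.I))‖ = 1 := by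
  have := norm_exp_int_mul_I (-k) t
  push_cast at this
  rwa [neg_mul, neg_mul] at this

theorem conj_exp_int_mul_I (k : ℤ) (t : ℝ) :
    (starRingEnd ℂ) (Complex.exp (k * t * Complex.I)) = Complex.exp (-(k * t * Complex.I)) := by
  rw [← Complex.exp_conj]
  simp

theorem memLp_comp_snd {f : ℝ → ℝ} (hf : MemLp f 2 axisVol) :
    MemLp (fun p : ℝ × ℝ => f p.2) 2 rectVol := by
  rw [rectVol_eq_prod]
  exact hf.comp_snd _

theorem memLp_exp_mul {f : ℝ → ℝ} (hf : MemLp f 2 axisVol) (k : ℤ) :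
    MemLp (fun p : ℝ × ℝ => Complex.exp (k * p.1 * Complex.I) * (f p.2 : ℂ)) 2 rectVol := by
  refine (memLp_comp_snd hf).mono ?_ (.of_forall fun p => ?_)
  · refine AEStronglyMeasurable.mul (Continuous.aestronglyMeasurable (by fun_prop)) ?_
    exact Complex.continuous_ofReal.comp_aestronglyMeasurable
      (memLp_comp_snd hf).aestronglyMeasurable
  · rw [norm_mul, norm_exp_int_mul_I, one_mul, Complex.norm_real]

theorem memLp_exp_neg_mul {f : ℝ → ℝ} (hf : MemLp f 2 axisVol) (k : ℤ) :
    MemLp (fun p : ℝ × ℝ => Complex.exp (-(k * p.1 * Complex.I)) * (f p.2 : ℂ)) 2 rectVol := by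
  convert memLp_exp_mul hf (-k) using 4
  push_cast
  ring_nf

theorem memLp_mode (k : ℤ) {f : ℝ → ℝ} (hm : Measurable f) (hf : MemLp f 2 axisVol) :
    MemLp (mode k f) 2 sigma := by
  rw [← measurePreserving_cyl.map_eq, memLp_map_measure_iff
    (measurable_mode k hm).aestronglyMeasurable measurable_cyl.aemeasurable,
    memLp_rectMeasure_iff]
  refine (memLp_exp_mul hf k).ae_eq ?_
  filter_upwards [ae_restrict_mem measurableSet_rect] with p hp
  exact (mode_cyl k f hp.2).symm

/-- The function `e^{ikθ} f(z)` as an element of `L²(S²)`. -/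
noncomputable def modeLp (k : ℤ) (f : ℝ → ℝ) (hm : Measurable f) (hf : MemLp f 2 axisVol) : L2 :=
  (memLp_mode k hm hf).toLp

theorem modeLp_cyl_ae_eq (k : ℤ) (f : ℝ → ℝ) (hm : Measurable f) (hf : MemLp f 2 axisVol) :
    (fun p => modeLp k f hm hf (cyl p)) =ᵐ[rectVol]
      fun p => Complex.exp (k * p.1 * Complex.I) * (f p.2 : ℂ) := by
  refine (comp_cyl_ae_eq (memLp_mode k hm hf).coeFn_toLp).trans ?_
  filter_upwards [ae_restrict_mem measurableSet_rect] with p hp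
  exact mode_cyl k f hp.2

/-- The pairing `∫ u(θ, z) e^{-ikθ} f(z) dθ dz`. -/
noncomputable def modePairing (k : ℤ) (f : ℝ → ℝ) (u : L2) : ℂ :=
  ∫ p in rect, u (cyl p) * (Complex.exp (-(k * p.1 * Complex.I)) * (f p.2 : ℂ))

theorem inner_modeLp (k : ℤ) (f : ℝ → ℝ) (hm : Measurable f) (hf : MemLp f 2 axisVol) (u : L2) :
    inner ℂ (modeLp k f hm hf) u = (4 * Real.pi : ℂ)⁻¹ * modePairing k f u := by
  rw [inner_eq_integral_rect, modePairing]
  congr 1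
  refine integral_congr_ae ?_
  filter_upwards [modeLp_cyl_ae_eq k f hm hf] with p hp
  rw [hp, map_mul, conj_exp_int_mul_I, Complex.conj_ofReal]

theorem integrable_modePairing (k : ℤ) {f : ℝ → ℝ} (hf : MemLp f 2 axisVol) (u : L2) :
    Integrable (fun p : ℝ × ℝ =>
      u (cyl p) * (Complex.exp (-(k * p.1 * Complex.I)) * (f p.2 : ℂ))) rectVol :=
  (memLp_comp_cyl u).integrable_mul (memLp_exp_neg_mul hf k)

theorem modePairing_add (k : ℤ) {f g : ℝ → ℝ} (hf : MemLp f 2 axisVol) (hg : MemLp g 2 axisVol)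
    (u : L2) : modePairing k (fun z => f z + g z) u = modePairing k f u + modePairing k g u := by
  rw [modePairing, modePairing, modePairing,
    ← integral_add (integrable_modePairing k hf u) (integrable_modePairing k hg u)]
  congr 1 with p
  push_cast
  ring

theorem modePairing_const_mul (k : ℤ) (c : ℝ) (f : ℝ → ℝ) (u : L2) :
    modePairing k (fun z => c * f z) u = c * modePairing k f u := by
  rw [modePairing, modePairing, ← integral_const_mul]
  congr 1 with p
  push_cast
  ring

theorem modePairing_congr (k : ℤ) {f g : ℝ → ℝ} (h : ∀ z ∈ Set.Ioo (-1 : ℝ) 1, f z = g z)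
    (u : L2) : modePairing k f u = modePairing k g u := by
  refine setIntegral_congr_fun measurableSet_rect fun p hp => ?_
  simp only [h p.2 hp.2]

/-- Dominated convergence for the pairing. -/
theorem tendsto_modePairing (k : ℤ) (u : L2) {f : ℕ → ℝ → ℝ} {g b : ℝ → ℝ}
    (hf : ∀ n, MemLp (f n) 2 axisVol) (hb : MemLp b 2 axisVol)
    (hfb : ∀ n, ∀ z ∈ Set.Ioo (-1 : ℝ) 1, |f n z| ≤ |b z|)
    (hlim : ∀ z ∈ Set.Ioo (-1 : ℝ) 1, ∀ᶠ n in Filter.atTop, f n z = g z) :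
    Filter.Tendsto (fun n => modePairing k (f n) u) Filter.atTop (nhds (modePairing k g u)) := by
  refine tendsto_integral_of_dominated_convergence _
    (fun n => (integrable_modePairing k (hf n) u).aestronglyMeasurable)
    (integrable_modePairing k hb u).norm (fun n => ?_) ?_
  · filter_upwards [ae_restrict_mem measurableSet_rect] with p hp
    simp only [norm_mul, norm_exp_neg_int_mul_I, Complex.norm_real, one_mul]
    exact mul_le_mul_of_nonneg_left (hfb n _ hp.2) (norm_nonneg _)
  · filter_upwards [ae_restrict_mem measurableSet_rect] with p hp
    refine tendsto_const_nhds.congr' ?_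
    filter_upwards [hlim _ hp.2] with n hn
    rw [hn]

/-! ### Test functions and the weak magnetic gradient -/

theorem one_sub_sq_pos {z : ℝ} (hz : z ∈ Set.Ioo (-1 : ℝ) 1) : 0 < 1 - z ^ 2 := by
  nlinarith [hz.1, hz.2]

namespace IsTest

variable {φ : ℝ × ℝ → ℂ}

theorem exists_radius (hφ : IsTest φ) :
    ∃ r : ℝ, 0 ≤ r ∧ r < 1 ∧ ∀ t z : ℝ, r < |z| → φ (t, z) = 0 := by
  obtain ⟨r, hr, h⟩ := hφ.supp
  exact ⟨max r 0, le_max_right _ _, max_lt hr one_pos,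
    fun t z hz => h t z ((le_max_left _ _).trans_lt hz)⟩

theorem hasDerivAt_snd (hφ : IsTest φ) (t z : ℝ) :
    HasDerivAt (fun z => φ (t, z)) (fderiv ℝ φ (t, z) (0, 1)) z := by
  have h := (hφ.smooth.differentiable (by simp) (t, z)).hasFDerivAt
  exact h.comp_hasDerivAt z ((hasDerivAt_const z t).prodMk (hasDerivAt_id z))

theorem hasDerivAt_fst (hφ : IsTest φ) (t z : ℝ) :
    HasDerivAt (fun t => φ (t, z)) (fderiv ℝ φ (t, z) (1, 0)) t := by
  have h := (hφ.smooth.differentiable (by simp) (t, z)).hasFDerivAt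
  exact h.comp_hasDerivAt t ((hasDerivAt_id t).prodMk (hasDerivAt_const t z))

theorem continuous_fderiv_apply (hφ : IsTest φ) (v : ℝ × ℝ) :
    Continuous fun p => fderiv ℝ φ p v :=
  (hφ.smooth.continuous_fderiv (by simp)).clm_apply continuous_const

theorem memLp_deriv_snd (hφ : IsTest φ) :
    MemLp (fun p : ℝ × ℝ => deriv (fun z => φ (p.1, z)) p.2) 2 rectVol := by
  refine (continuous_memLp_rectVol (hφ.continuous_fderiv_apply (0, 1))).ae_eq
    (.of_forall fun p => ?_)
  exact (hφ.hasDerivAt_snd p.1 p.2).deriv.symm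

theorem memLp_magneticDeriv (hφ : IsTest φ) (a : ℝ) :
    MemLp (fun p : ℝ × ℝ => deriv (fun t => φ (t, p.2)) p.1 + Complex.I * a * φ p) 2 rectVol := by
  refine MemLp.add ?_ (continuous_memLp_rectVol (by have := hφ.smooth.continuous; fun_prop))
  refine (continuous_memLp_rectVol (hφ.continuous_fderiv_apply (1, 0))).ae_eq
    (.of_forall fun p => ?_)
  exact (hφ.hasDerivAt_fst p.1 p.2).deriv.symm

theorem memLp_sqrt_mul (hφ : IsTest φ) :
    MemLp (fun p : ℝ × ℝ => ((√(1 - p.2 ^ 2) : ℝ) : ℂ) * φ p) 2 rectVol :=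
  continuous_memLp_rectVol (by have := hφ.smooth.continuous; fun_prop)

/-- The weight is singular only at the poles, where φ vanishes; on |z| ≤ r it is bounded by (1 -
r²)^{-1/2}. -/
theorem memLp_div_sqrt (hφ : IsTest φ) :
    MemLp (fun p : ℝ × ℝ => φ p / ((√(1 - p.2 ^ 2) : ℝ) : ℂ)) 2 rectVol := by
  obtain ⟨r, hr0, hr1, hr⟩ := hφ.exists_radius
  have hs : 0 < √(1 - r ^ 2) := Real.sqrt_pos.2 (by nlinarith)
  refine ((continuous_memLp_rectVol hφ.smooth.continuous).const_mul
    ((√(1 - r ^ 2) : ℝ) : ℂ)⁻¹).mono ?_ (.of_forall fun p => ?_)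
  · have := hφ.smooth.continuous.measurable
    exact Measurable.aestronglyMeasurable (by fun_prop)
  · by_cases h : r < |p.2|
    · rw [show φ p = 0 from hr p.1 p.2 h]; simp
    · rw [norm_div, norm_mul, norm_inv, Complex.norm_real, Complex.norm_real, div_eq_inv_mul,
        Real.norm_of_nonneg (Real.sqrt_nonneg _), Real.norm_of_nonneg (Real.sqrt_nonneg _)]
      have h2 : p.2 ^ 2 ≤ r ^ 2 := by
        rw [← sq_abs p.2]; exact pow_le_pow_left₀ (abs_nonneg _) (not_lt.1 h) 2
      gcongr

end IsTest

/-- In this form each test function contributes two equations that are continuous and linear in (u,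
g₁, g₂), which is what makes the graph closed. -/
theorem hasMagneticGradient_iff {a : ℝ} {u g₁ g₂ : L2} :
    HasMagneticGradient a u g₁ g₂ ↔ ∀ φ : ℝ × ℝ → ℂ, IsTest φ →
      (∫ p in rect, u (cyl p) * deriv (fun z => φ (p.1, z)) p.2) +
        (∫ p in rect, g₁ (cyl p) * (φ p / ((√(1 - p.2 ^ 2) : ℝ) : ℂ))) = 0 ∧
      (∫ p in rect, u (cyl p) * (deriv (fun t => φ (t, p.2)) p.1 + Complex.I * a * φ p)) +
        (∫ p in rect, g₂ (cyl p) * (((√(1 - p.2 ^ 2) : ℝ) : ℂ) * φ p)) = 0 := by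
  have e1 : ∀ (φ : ℝ × ℝ → ℂ) (p : ℝ × ℝ), g₁ (cyl p) / ((√(1 - p.2 ^ 2) : ℝ) : ℂ) * φ p =
      g₁ (cyl p) * (φ p / ((√(1 - p.2 ^ 2) : ℝ) : ℂ)) := fun φ p => by ring
  have e2 : ∀ (φ : ℝ × ℝ → ℂ) (p : ℝ × ℝ), ((√(1 - p.2 ^ 2) : ℝ) : ℂ) * g₂ (cyl p) * φ p =
      g₂ (cyl p) * (((√(1 - p.2 ^ 2) : ℝ) : ℂ) * φ p) := fun φ p => by ring
  constructor
  · intro h φ hφ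
    have h1 := h.dz φ hφ
    have h2 := h.dtheta φ hφ
    simp only [e1] at h1
    simp only [e2] at h2
    exact ⟨eq_neg_iff_add_eq_zero.1 h1, eq_neg_iff_add_eq_zero.1 h2⟩
  · intro h
    constructor
    · intro φ hφ
      simp only [e1]
      exact eq_neg_iff_add_eq_zero.2 (h φ hφ).1
    · intro φ hφ
      simp only [e2]
      exact eq_neg_iff_add_eq_zero.2 (h φ hφ).2

/-- The integral over `(-1, 1)` of the derivative of a compactly supported function vanishes. -/
theorem integral_deriv_eq_zero {h h' : ℝ → ℂ} {r : ℝ} (hr0 : 0 ≤ r) (hr1 : r < 1)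
    (hd : ∀ z ∈ Set.Ioo (-1 : ℝ) 1, HasDerivAt h (h' z) z)
    (hc : ContinuousOn h' (Set.Ioo (-1) 1)) (h0 : ∀ z, r < |z| → h z = 0) :
    ∫ z in Set.Ioo (-1 : ℝ) 1, h' z = 0 := by
  have h'0 : ∀ z ∈ Set.Ioo (-1 : ℝ) 1, r < |z| → h' z = 0 := by
    intro z hz hrz
    have : h =ᶠ[nhds z] fun _ => 0 := by
      filter_upwards [(isOpen_lt continuous_const continuous_abs).mem_nhds hrz] with y hy
      exact h0 y hy
    exact (hd z hz).unique ((hasDerivAt_const z (0 : ℂ)).congr_of_eventuallyEq this)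
  -- Strictly between r and 1, so that h vanishes at ±s while [-s, s] stays inside the open
  -- interval, where h is differentiable.
  set s := (1 + r) / 2 with hs
  have hs1 : s < 1 := by linarith
  have hrs : r < s := by linarith
  have hss : -s ≤ s := by linarith
  have hsub : Set.Icc (-s) s ⊆ Set.Ioo (-1) 1 := fun z hz =>
    ⟨by linarith [hz.1], by linarith [hz.2]⟩
  rw [setIntegral_eq_of_subset_of_forall_sdiff_eq_zero (s := Set.Ioc (-s) s) measurableSet_Ioo
    (Set.Ioc_subset_Icc_self.trans hsub), ← intervalIntegral.integral_of_le hss,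
    intervalIntegral.integral_eq_sub_of_hasDerivAt (f := h)]
  · rw [h0 s (by rw [abs_of_pos (by linarith)]; exact hrs),
      h0 (-s) (by rw [abs_neg, abs_of_pos (by linarith)]; exact hrs), sub_zero]
  · rw [Set.uIcc_of_le hss]
    exact fun z hz => hd z (hsub hz)
  · apply ContinuousOn.intervalIntegrable
    rw [Set.uIcc_of_le hss]
    exact hc.mono hsub
  · intro z hz
    apply h'0 z hz.1
    by_contra! hle
    have := abs_le.1 hle
    exact hz.2 ⟨by linarith, by linarith⟩

theorem integral_rect_eq_theta_last {f : ℝ × ℝ → ℂ} (hf : Integrable f rectVol) :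
    ∫ p in rect, f p =
      ∫ z in Set.Ioo (-1 : ℝ) 1, ∫ t in Set.Ioo 0 (2 * Real.pi), f (t, z) := by
  change ∫ p, f p ∂rectVol = _
  rw [rectVol_eq_prod] at hf ⊢
  exact integral_prod_symm f hf

theorem integral_rect_eq_z_last {f : ℝ × ℝ → ℂ} (hf : Integrable f rectVol) :
    ∫ p in rect, f p =
      ∫ t in Set.Ioo 0 (2 * Real.pi), ∫ z in Set.Ioo (-1 : ℝ) 1, f (t, z) := by
  change ∫ p, f p ∂rectVol = _
  rw [rectVol_eq_prod] at hf ⊢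
  exact integral_prod f hf

/-! ### Radial profiles and their magnetic gradients -/

/-- Radial profiles `F` for which `e^{ikθ} F(z)` has finite magnetic energy. -/
structure IsRadial (a : ℝ) (k : ℤ) (F : ℝ → ℝ) : Prop where
  smooth : ContDiffOn ℝ ∞ F (Set.Ioo (-1) 1)
  meas : Measurable F
  memLp : MemLp F 2 axisVol
  memLp_dz : MemLp (fun z => √(1 - z ^ 2) * deriv F z) 2 axisVol
  memLp_dtheta : MemLp (fun z => (k - a) * (F z / √(1 - z ^ 2))) 2 axisVol
  memLp_deriv : (k : ℝ) = a → MemLp (deriv F) 2 axisVol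

namespace IsRadial

variable {a : ℝ} {k : ℤ} {F : ℝ → ℝ}

theorem hasDerivAt (hF : IsRadial a k F) {z : ℝ} (hz : z ∈ Set.Ioo (-1 : ℝ) 1) :
    HasDerivAt F (deriv F z) z :=
  ((hF.smooth.differentiableOn (by simp)).differentiableAt
    (isOpen_Ioo.mem_nhds hz)).hasDerivAt

theorem contDiffOn_deriv (hF : IsRadial a k F) : ContDiffOn ℝ ∞ (deriv F) (Set.Ioo (-1) 1) :=
  hF.smooth.deriv_of_isOpen isOpen_Ioo (by simp)

theorem meas_dz (_ : IsRadial a k F) : Measurable fun z => √(1 - z ^ 2) * deriv F z := by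
  have := measurable_deriv F
  fun_prop

theorem meas_dtheta (hF : IsRadial a k F) :
    Measurable fun z => (k - a) * (F z / √(1 - z ^ 2)) := by
  have := hF.meas
  fun_prop

/-- The element `e^{ikθ} F(z)` of `L²(S²)`. -/
noncomputable def toLp (hF : IsRadial a k F) : L2 := modeLp k F hF.meas hF.memLp

/-- First component of the magnetic gradient of `e^{ikθ} F(z)`. -/
noncomputable def gradZ (hF : IsRadial a k F) : L2 := modeLp k _ hF.meas_dz hF.memLp_dz

/-- Second component of the magnetic gradient of `e^{ikθ} F(z)`. -/
noncomputable def gradTheta (hF : IsRadial a k F) : L2 :=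
  Complex.I • modeLp k _ hF.meas_dtheta hF.memLp_dtheta

theorem gradTheta_cyl_ae_eq (hF : IsRadial a k F) :
    (fun p => hF.gradTheta (cyl p)) =ᵐ[rectVol] fun p => Complex.I *
      (Complex.exp (k * p.1 * Complex.I) * (((k - a) * (F p.2 / √(1 - p.2 ^ 2)) : ℝ) : ℂ)) := by
  refine (comp_cyl_ae_eq (Lp.coeFn_smul Complex.I _)).trans ?_
  filter_upwards [modeLp_cyl_ae_eq k _ hF.meas_dtheta hF.memLp_dtheta] with p hp
  simp only [Pi.smul_apply, smul_eq_mul, hp]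

/-- By Fubini each identity reduces to the integral of an exact derivative: in z it vanishes because
φ does near the poles, in θ because e^{ikθ} φ is 2π-periodic. -/
theorem hasMagneticGradient (hF : IsRadial a k F) :
    HasMagneticGradient a hF.toLp hF.gradZ hF.gradTheta := by
  have e0 := modeLp_cyl_ae_eq k _ hF.meas hF.memLp
  have e1 := modeLp_cyl_ae_eq k _ hF.meas_dz hF.memLp_dz
  have e2 := hF.gradTheta_cyl_ae_eq
  refine hasMagneticGradient_iff.2 fun φ hφ => ⟨?_, ?_⟩
  · obtain ⟨r, hr0, hr1, hr⟩ := hφ.exists_radius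
    have i0 := (memLp_comp_cyl hF.toLp).integrable_mul hφ.memLp_deriv_snd
    have i1 := (memLp_comp_cyl hF.gradZ).integrable_mul hφ.memLp_div_sqrt
    have key : ∀ᵐ p ∂rectVol, ((fun p => hF.toLp (cyl p)) *
        fun p : ℝ × ℝ => deriv (fun z => φ (p.1, z)) p.2) p + ((fun p => hF.gradZ (cyl p)) *
        fun p : ℝ × ℝ => φ p / ((√(1 - p.2 ^ 2) : ℝ) : ℂ)) p =
        Complex.exp (k * p.1 * Complex.I) * ((F p.2 : ℂ) * fderiv ℝ φ p (0, 1) +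
          ((deriv F p.2 : ℝ) : ℂ) * φ p) := by
      filter_upwards [e0, e1, ae_restrict_mem measurableSet_rect] with p h0 h1 hp
      have hs : ((√(1 - p.2 ^ 2) : ℝ) : ℂ) ≠ 0 := by
        exact_mod_cast (Real.sqrt_pos.2 (one_sub_sq_pos hp.2)).ne'
      simp only [Pi.mul_apply, toLp, gradZ, h0, h1, (hφ.hasDerivAt_snd p.1 p.2).deriv]
      push_cast
      field_simp
    have hz : ∫ p in rect, (((fun p => hF.toLp (cyl p)) *
        fun p : ℝ × ℝ => deriv (fun z => φ (p.1, z)) p.2) p + ((fun p => hF.gradZ (cyl p)) *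
        fun p : ℝ × ℝ => φ p / ((√(1 - p.2 ^ 2) : ℝ) : ℂ)) p) = 0 := by
      rw [integral_congr_ae key, integral_rect_eq_z_last ((i0.add i1).congr key)]
      refine integral_eq_zero_of_ae (.of_forall fun t => ?_)
      change ∫ z in Set.Ioo (-1 : ℝ) 1, Complex.exp (k * t * Complex.I) *
        ((F z : ℂ) * fderiv ℝ φ (t, z) (0, 1) + ((deriv F z : ℝ) : ℂ) * φ (t, z)) = 0
      rw [integral_const_mul, integral_deriv_eq_zero hr0 hr1 (h := fun z => (F z : ℂ) * φ (t, z)),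
        mul_zero]
      · intro z hz
        exact ((hF.hasDerivAt hz).ofReal_comp.mul (hφ.hasDerivAt_snd t z)).congr_deriv (by ring)
      · have c1 : Continuous fun z : ℝ => fderiv ℝ φ (t, z) (0, 1) :=
          (hφ.continuous_fderiv_apply (0, 1)).comp (by fun_prop)
        have c2 : Continuous fun z : ℝ => φ (t, z) := hφ.smooth.continuous.comp (by fun_prop)
        exact ((Complex.continuous_ofReal.comp_continuousOn hF.smooth.continuousOn).mul
          c1.continuousOn).add ((Complex.continuous_ofReal.comp_continuousOn
          hF.contDiffOn_deriv.continuousOn).mul c2.continuousOn)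
      · intro z hz
        rw [hr t z hz, mul_zero]
    rw [integral_add i0 i1] at hz
    exact hz
  · have i0 := (memLp_comp_cyl hF.toLp).integrable_mul (hφ.memLp_magneticDeriv a)
    have i1 := (memLp_comp_cyl hF.gradTheta).integrable_mul hφ.memLp_sqrt_mul
    have key : ∀ᵐ p ∂rectVol, ((fun p => hF.toLp (cyl p)) *
        fun p : ℝ × ℝ => deriv (fun t => φ (t, p.2)) p.1 + Complex.I * a * φ p) p +
        ((fun p => hF.gradTheta (cyl p)) *
        fun p : ℝ × ℝ => ((√(1 - p.2 ^ 2) : ℝ) : ℂ) * φ p) p =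
        (F p.2 : ℂ) * (k * Complex.I * Complex.exp (k * p.1 * Complex.I) * φ p +
          Complex.exp (k * p.1 * Complex.I) * fderiv ℝ φ p (1, 0)) := by
      filter_upwards [e0, e2, ae_restrict_mem measurableSet_rect] with p h0 h1 hp
      have hs : ((√(1 - p.2 ^ 2) : ℝ) : ℂ) ≠ 0 := by
        exact_mod_cast (Real.sqrt_pos.2 (one_sub_sq_pos hp.2)).ne'
      simp only [Pi.mul_apply, toLp, h0, h1, (hφ.hasDerivAt_fst p.1 p.2).deriv]
      push_cast
      field_simp
      ring
    have hz : ∫ p in rect, (((fun p => hF.toLp (cyl p)) *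
        fun p : ℝ × ℝ => deriv (fun t => φ (t, p.2)) p.1 + Complex.I * a * φ p) p +
        ((fun p => hF.gradTheta (cyl p)) *
        fun p : ℝ × ℝ => ((√(1 - p.2 ^ 2) : ℝ) : ℂ) * φ p) p) = 0 := by
      rw [integral_congr_ae key, integral_rect_eq_theta_last ((i0.add i1).congr key)]
      refine integral_eq_zero_of_ae (.of_forall fun z => ?_)
      change ∫ t in Set.Ioo 0 (2 * Real.pi), (F z : ℂ) *
        (k * Complex.I * Complex.exp (k * t * Complex.I) * φ (t, z) +
          Complex.exp (k * t * Complex.I) * fderiv ℝ φ (t, z) (1, 0)) = 0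
      have c1 : Continuous fun t : ℝ => fderiv ℝ φ (t, z) (1, 0) :=
        (hφ.continuous_fderiv_apply (1, 0)).comp (by fun_prop)
      have c2 : Continuous fun t : ℝ => φ (t, z) := hφ.smooth.continuous.comp (by fun_prop)
      rw [integral_const_mul, ← integral_Ioc_eq_integral_Ioo,
        ← intervalIntegral.integral_of_le (by positivity),
        intervalIntegral.integral_eq_sub_of_hasDerivAt
          (f := fun t : ℝ => Complex.exp (k * t * Complex.I) * φ (t, z))]
      · have h1 : φ (2 * Real.pi, z) = φ (0, z) := by
          have := hφ.periodic 0 z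
          rwa [zero_add] at this
        have h2 : Complex.exp (k * ((2 * Real.pi : ℝ) : ℂ) * Complex.I) = 1 := by
          have := Complex.exp_int_mul_two_pi_mul_I k
          rw [← this]; congr 1; push_cast; ring
        rw [h1, h2]
        simp
      · intro t _
        have d : HasDerivAt (fun t : ℝ => Complex.exp (k * t * Complex.I))
            (Complex.exp (k * t * Complex.I) * (k * 1 * Complex.I)) t :=
          (((Complex.ofRealCLM.hasDerivAt (x := t)).const_mul (k : ℂ)).mul_const Complex.I).cexp
        exact (d.mul (hφ.hasDerivAt_fst t z)).congr_deriv (by ring)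
      · have c3 : Continuous fun t : ℝ => Complex.exp (k * t * Complex.I) := by fun_prop
        exact (((continuous_const.mul c3).mul c2).add (c3.mul c1)).intervalIntegrable _ _
    rw [integral_add i0 i1] at hz
    exact hz

end IsRadial

theorem memLp_axis_of_le {f b : ℝ → ℝ} (hb : MemLp b 2 axisVol) (hf : Measurable f)
    (h : ∀ z ∈ Set.Ioo (-1 : ℝ) 1, |f z| ≤ |b z|) : MemLp f 2 axisVol := by
  refine hb.mono hf.aestronglyMeasurable ?_
  filter_upwards [ae_restrict_mem measurableSet_Ioo] with z hz
  exact h z hz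

/-! ### Tests of the form e^{-ikθ} g(z), and polar cutoffs -/

/-- Smooth functions of `z` with compact support in `(-1, 1)`. -/
structure IsAxisTest (g : ℝ → ℝ) : Prop where
  smooth : ContDiff ℝ ∞ g
  supp : ∃ r < (1 : ℝ), ∀ z : ℝ, r < |z| → g z = 0

namespace IsAxisTest

variable {g : ℝ → ℝ}

theorem memLp (hg : IsAxisTest g) : MemLp g 2 axisVol := by
  obtain ⟨C, hC⟩ := (isCompact_Icc (a := (-1 : ℝ)) (b := 1)).exists_bound_of_continuousOn
    hg.smooth.continuous.continuousOn
  refine MemLp.of_bound hg.smooth.continuous.aestronglyMeasurable C ?_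
  filter_upwards [ae_restrict_mem measurableSet_Ioo] with z hz
  exact hC z (Set.Ioo_subset_Icc_self hz)

theorem isTest (hg : IsAxisTest g) (k : ℤ) :
    IsTest fun p => Complex.exp (-(k * p.1 * Complex.I)) * (g p.2 : ℂ) where
  smooth := by
    have h1 : ContDiff ℝ ∞ fun p : ℝ × ℝ => (p.1 : ℂ) :=
      Complex.ofRealCLM.contDiff.comp contDiff_fst
    have h2 : ContDiff ℝ ∞ fun p : ℝ × ℝ => (g p.2 : ℂ) :=
      Complex.ofRealCLM.contDiff.comp (hg.smooth.comp contDiff_snd)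
    exact (((contDiff_const.mul h1).mul contDiff_const).neg.cexp).mul h2
  periodic t z := by
    simp only
    congr 1
    have := Complex.exp_int_mul_two_pi_mul_I (-k)
    push_cast at this ⊢
    rw [show -((k : ℂ) * (t + 2 * Real.pi) * Complex.I) =
      -(k * t * Complex.I) + -k * (2 * Real.pi * Complex.I) by ring, Complex.exp_add, this, mul_one]
  supp := by
    obtain ⟨r, hr, h⟩ := hg.supp
    exact ⟨r, hr, fun t z hz => by rw [h z hz]; simp⟩

/-- A compactly supported cutoff times a function that is smooth on `(-1, 1)`. -/
theorem mul (hg : IsAxisTest g) {f : ℝ → ℝ} (hf : ContDiffOn ℝ ∞ f (Set.Ioo (-1) 1)) :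
    IsAxisTest fun z => g z * f z where
  smooth := by
    obtain ⟨r, hr, h⟩ := hg.supp
    rw [contDiff_iff_contDiffAt]
    intro z
    by_cases hz : r < |z|
    · have : (fun z => g z * f z) =ᶠ[nhds z] fun _ => 0 := by
        filter_upwards [(isOpen_lt continuous_const continuous_abs).mem_nhds hz] with y hy
        rw [h y hy, zero_mul]
      exact contDiffAt_const.congr_of_eventuallyEq this
    · have hz' := abs_lt.1 ((not_lt.1 hz).trans_lt hr)
      exact hg.smooth.contDiffAt.mul (hf.contDiffAt (isOpen_Ioo.mem_nhds hz'))
  supp := by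
    obtain ⟨r, hr, h⟩ := hg.supp
    exact ⟨r, hr, fun z hz => by rw [h z hz, zero_mul]⟩

theorem deriv (hg : IsAxisTest g) : IsAxisTest (deriv g) where
  smooth := by
    have h := hg.smooth
    rw [show (∞ : WithTop ℕ∞) = ∞ + 1 from rfl, contDiff_succ_iff_deriv] at h
    exact h.2.2
  supp := by
    obtain ⟨r, hr, h⟩ := hg.supp
    refine ⟨r, hr, fun z hz => ?_⟩
    have : g =ᶠ[nhds z] fun _ => 0 := by
      filter_upwards [(isOpen_lt continuous_const continuous_abs).mem_nhds hz] with y hy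
      exact h y hy
    rw [this.deriv_eq, deriv_const]

end IsAxisTest

section

variable {a : ℝ} {v h₁ h₂ : L2} {g : ℝ → ℝ}

theorem HasMagneticGradient.modePairing_dz (h : HasMagneticGradient a v h₁ h₂) (k : ℤ)
    (hg : IsAxisTest g) : modePairing k (deriv g) v =
      -modePairing k (fun z => g z / √(1 - z ^ 2)) h₁ := by
  have e := (hasMagneticGradient_iff.1 h _ (hg.isTest k)).1
  rw [eq_neg_iff_add_eq_zero, ← e, modePairing, modePairing]
  congr 3 with p
  · congr 1
    have d : HasDerivAt (fun z => (g z : ℂ)) ((deriv g p.2 : ℝ) : ℂ) p.2 :=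
      ((hg.smooth.differentiable (by simp) p.2).hasDerivAt).ofReal_comp
    exact (d.const_mul (Complex.exp (-(k * p.1 * Complex.I)))).deriv.symm
  · push_cast
    ring

/-- On the k-th Fourier mode the angular derivative is multiplication by i(k - a). For k ≠ a this
controls the mode of v by h₂ with an extra factor √(1 - z²), which is the source of decay at the
poles. -/
theorem HasMagneticGradient.modePairing_dtheta (h : HasMagneticGradient a v h₁ h₂) (k : ℤ)
    (hg : IsAxisTest g) : Complex.I * (a - k) * modePairing k g v =
      -modePairing k (fun z => √(1 - z ^ 2) * g z) h₂ := by
  have e := (hasMagneticGradient_iff.1 h _ (hg.isTest k)).2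
  rw [eq_neg_iff_add_eq_zero, ← e, modePairing, modePairing, ← integral_const_mul]
  congr 3 with p
  · have d : HasDerivAt (fun t : ℝ => Complex.exp (-(k * t * Complex.I)) * (g p.2 : ℂ))
        (Complex.exp (-(k * p.1 * Complex.I)) * (-(k * 1 * Complex.I)) * (g p.2 : ℂ)) p.1 :=
      ((((Complex.ofRealCLM.hasDerivAt (x := p.1)).const_mul (k : ℂ)).mul_const
        Complex.I).neg.cexp).mul_const _
    rw [d.deriv]
    ring
  · push_cast
    ring

end

/-- Smooth cutoffs near the poles. -/
noncomputable def cutoff (n : ℕ) (z : ℝ) : ℝ :=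
  Real.smoothTransition ((n + 1) * (1 - z ^ 2) - 1)

theorem isAxisTest_cutoff (n : ℕ) : IsAxisTest (cutoff n) where
  smooth := Real.smoothTransition.contDiff.comp (by fun_prop)
  supp := by
    refine ⟨√(1 - 1 / (n + 1)), ?_, fun z hz => ?_⟩
    · rw [Real.sqrt_lt' one_pos]
      have : (0 : ℝ) < 1 / (n + 1) := by positivity
      linarith
    · apply Real.smoothTransition.zero_of_nonpos
      have h := Real.lt_sq_of_sqrt_lt hz
      rw [sq_abs] at h
      have h1 : 1 - z ^ 2 < 1 / (n + 1) := by linarith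
      rw [lt_div_iff₀ (by positivity)] at h1
      linarith

theorem abs_cutoff_le (n : ℕ) (z : ℝ) : |cutoff n z| ≤ 1 :=
  abs_le.2 ⟨by linarith [Real.smoothTransition.nonneg ((n + 1) * (1 - z ^ 2) - 1 : ℝ), cutoff.eq_1 n z],
    Real.smoothTransition.le_one _⟩

theorem eventually_two_lt {z : ℝ} (hz : z ∈ Set.Ioo (-1 : ℝ) 1) :
    ∀ᶠ n : ℕ in Filter.atTop, 1 < ((n + 1) * (1 - z ^ 2) - 1 : ℝ) := by
  have h := one_sub_sq_pos hz
  filter_upwards [(tendsto_natCast_atTop_atTop (R := ℝ)).eventually_gt_atTop (2 / (1 - z ^ 2))]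
    with n hn
  rw [div_lt_iff₀ h] at hn
  nlinarith

theorem eventually_cutoff_eq_one {z : ℝ} (hz : z ∈ Set.Ioo (-1 : ℝ) 1) :
    ∀ᶠ n : ℕ in Filter.atTop, cutoff n z = 1 := by
  filter_upwards [eventually_two_lt hz] with n hn
  exact Real.smoothTransition.one_of_one_le hn.le

theorem deriv_smoothTransition_of_one_lt {y : ℝ} (hy : 1 < y) :
    deriv Real.smoothTransition y = 0 := by
  have : Real.smoothTransition =ᶠ[nhds y] fun _ => 1 := by
    filter_upwards [lt_mem_nhds hy] with x hx
    exact Real.smoothTransition.one_of_one_le hx.le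
  rw [this.deriv_eq, deriv_const]

theorem deriv_smoothTransition_of_neg {y : ℝ} (hy : y < 0) :
    deriv Real.smoothTransition y = 0 := by
  have : Real.smoothTransition =ᶠ[nhds y] fun _ => 0 := by
    filter_upwards [gt_mem_nhds hy] with x hx
    exact Real.smoothTransition.zero_of_nonpos hx.le
  rw [this.deriv_eq, deriv_const]

theorem exists_deriv_smoothTransition_bound :
    ∃ C : ℝ, 0 ≤ C ∧ ∀ y, |deriv Real.smoothTransition y| ≤ C := by
  have hc : Continuous (deriv Real.smoothTransition) :=
    (Real.smoothTransition.contDiff (n := 1)).continuous_deriv (by simp)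
  obtain ⟨C, hC⟩ := (isCompact_Icc (a := (0 : ℝ)) (b := 1)).exists_bound_of_continuousOn
    hc.continuousOn
  have h0 : 0 ≤ C := (norm_nonneg _).trans (hC 0 (by simp))
  refine ⟨C, h0, fun y => ?_⟩
  rcases lt_or_ge y 0 with h | h
  · rwa [deriv_smoothTransition_of_neg h, abs_zero]
  rcases lt_or_ge 1 y with h' | h'
  · rwa [deriv_smoothTransition_of_one_lt h', abs_zero]
  · exact hC y ⟨h, h'⟩

theorem deriv_cutoff (n : ℕ) (z : ℝ) : deriv (cutoff n) z =
    deriv Real.smoothTransition ((n + 1) * (1 - z ^ 2) - 1) * ((n + 1) * (-(2 * z))) := by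
  have h1 : HasDerivAt Real.smoothTransition _ ((n + 1) * (1 - z ^ 2) - 1 : ℝ) :=
    ((Real.smoothTransition.contDiff (n := 1)).differentiable (by simp) _).hasDerivAt
  have h2 : HasDerivAt (fun z : ℝ => ((n + 1) * (1 - z ^ 2) - 1 : ℝ)) ((n + 1) * (-(2 * z))) z := by
    have := (((hasDerivAt_pow 2 z).const_sub 1).const_mul (n + 1 : ℝ)).sub_const 1
    simpa using this
  exact (h1.comp z h2).deriv

theorem eventually_deriv_cutoff_eq_zero {z : ℝ} (hz : z ∈ Set.Ioo (-1 : ℝ) 1) :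
    ∀ᶠ n : ℕ in Filter.atTop, deriv (cutoff n) z = 0 := by
  filter_upwards [eventually_two_lt hz] with n hn
  rw [deriv_cutoff, deriv_smoothTransition_of_one_lt hn, zero_mul]

/-- The derivative has size n + 1, but it lives where (n + 1)(1 - z²) ≤ 2, so the factor 1 - z²
compensates its growth. -/
theorem exists_deriv_cutoff_bound : ∃ C : ℝ, ∀ (n : ℕ), ∀ z ∈ Set.Ioo (-1 : ℝ) 1,
    |deriv (cutoff n) z * (1 - z ^ 2)| ≤ C := by
  obtain ⟨C, h0, hC⟩ := exists_deriv_smoothTransition_bound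
  -- One factor 2 comes from differentiating z², the other from the bound (n + 1)(1 - z²) ≤ 2.
  refine ⟨C * 4, fun n z hz => ?_⟩
  rw [deriv_cutoff]
  rcases lt_or_ge 1 ((n + 1) * (1 - z ^ 2) - 1 : ℝ) with h | h
  · rw [deriv_smoothTransition_of_one_lt h]
    simp [h0]
  · rw [mul_assoc, abs_mul]
    have hp := one_sub_sq_pos hz
    have hz1 : |z| ≤ 1 := abs_le.2 ⟨hz.1.le, hz.2.le⟩
    refine mul_le_mul (hC _) ?_ (abs_nonneg _) h0
    rw [show ((n + 1) * (-(2 * z)) * (1 - z ^ 2) : ℝ) = (-2) * (((n + 1) * (1 - z ^ 2)) * z) by ring,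
      abs_mul, abs_mul, abs_of_pos (show (0 : ℝ) < (n + 1) * (1 - z ^ 2) by positivity)]
    have : (n + 1) * (1 - z ^ 2) * |z| ≤ 2 * 1 :=
      mul_le_mul (by linarith) hz1 (abs_nonneg _) (by norm_num)
    rw [abs_neg, abs_two]
    linarith

/-! ### Green's formula up to the poles -/

namespace IsRadial

variable {a : ℝ} {k : ℤ} {F : ℝ → ℝ} {v h₁ h₂ : L2}

/-- The boundary terms at the poles vanish. -/
theorem tendsto_boundary (hF : IsRadial a k F) (h : HasMagneticGradient a v h₁ h₂) :
    Filter.Tendsto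
      (fun n => modePairing k (fun z => deriv (cutoff n) z * ((1 - z ^ 2) * deriv F z)) v)
      Filter.atTop (nhds 0) := by
  obtain ⟨C, hC⟩ := exists_deriv_cutoff_bound
  have hmF := measurable_deriv F
  have hmc : ∀ n, Measurable (deriv (cutoff n)) := fun n => measurable_deriv _
  have h00 : ∀ w : L2, modePairing k (fun _ => 0) w = 0 := fun w => by simp [modePairing]
  have hG : ContDiffOn ℝ ∞ (fun z => (1 - z ^ 2) * deriv F z) (Set.Ioo (-1) 1) :=
    ContDiffOn.mul (by fun_prop) hF.contDiffOn_deriv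
  have hbd : ∀ (n : ℕ), ∀ z ∈ Set.Ioo (-1 : ℝ) 1, ∀ y : ℝ,
      |deriv (cutoff n) z * (1 - z ^ 2) * y| ≤ |C * y| := by
    intro n z hz y
    rw [abs_mul, abs_mul C]
    exact mul_le_mul_of_nonneg_right ((hC n z hz).trans (le_abs_self C)) (abs_nonneg _)
  by_cases hk : (k : ℝ) = a
  -- For k = a the angular identity gives no information, so domination uses C |F'|, square
  -- integrable by `memLp_deriv`.
  · rw [← h00 v]
    have hle : ∀ (n : ℕ), ∀ z ∈ Set.Ioo (-1 : ℝ) 1,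
        |deriv (cutoff n) z * ((1 - z ^ 2) * deriv F z)| ≤ |C * deriv F z| := by
      intro n z hz
      rw [← mul_assoc]
      exact hbd n z hz _
    refine tendsto_modePairing k v (fun n => ((isAxisTest_cutoff n).deriv.mul hG).memLp)
      ((hF.memLp_deriv hk).const_mul C) hle fun z hz => ?_
    filter_upwards [eventually_deriv_cutoff_eq_zero hz] with n hn
    rw [hn, zero_mul]
  -- For k ≠ a the pairing with v is traded for one with h₂; the gained factor √(1 - z²) leaves only
  -- C √(1 - z²) |F'| to dominate, which is finite energy.
  · have hk' : (Complex.I * (a - k) : ℂ) ≠ 0 := by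
      refine mul_ne_zero Complex.I_ne_zero (sub_ne_zero.2 ?_)
      exact_mod_cast Ne.symm hk
    have e : ∀ n, modePairing k (fun z => deriv (cutoff n) z * ((1 - z ^ 2) * deriv F z)) v =
        -(Complex.I * (a - k))⁻¹ * modePairing k
          (fun z => √(1 - z ^ 2) * (deriv (cutoff n) z * ((1 - z ^ 2) * deriv F z))) h₂ := by
      intro n
      have := h.modePairing_dtheta k ((isAxisTest_cutoff n).deriv.mul hG)
      rw [neg_mul, ← mul_neg, ← this, inv_mul_cancel_left₀ hk']
    simp only [e]
    rw [← mul_zero (-(Complex.I * (a - k) : ℂ)⁻¹), ← h00 h₂]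
    refine Filter.Tendsto.const_mul _ ?_
    have hle : ∀ (n : ℕ), ∀ z ∈ Set.Ioo (-1 : ℝ) 1,
        |√(1 - z ^ 2) * (deriv (cutoff n) z * ((1 - z ^ 2) * deriv F z))| ≤
          |C * (√(1 - z ^ 2) * deriv F z)| := by
      intro n z hz
      rw [show √(1 - z ^ 2) * (deriv (cutoff n) z * ((1 - z ^ 2) * deriv F z)) =
        deriv (cutoff n) z * (1 - z ^ 2) * (√(1 - z ^ 2) * deriv F z) by ring]
      exact hbd n z hz _
    have hb := hF.memLp_dz.const_mul C
    refine tendsto_modePairing k h₂ (fun n => memLp_axis_of_le hb ?_ (hle n)) hb hle fun z hz => ?_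
    · have := hmc n
      fun_prop
    · filter_upwards [eventually_deriv_cutoff_eq_zero hz] with n hn
      rw [hn, zero_mul, mul_zero]

theorem tendsto_cutoff_mul (k : ℤ) (u : L2) {f : ℝ → ℝ} (hm : Measurable f)
    (hf : MemLp f 2 axisVol) :
    Filter.Tendsto (fun n => modePairing k (fun z => cutoff n z * f z) u)
      Filter.atTop (nhds (modePairing k f u)) := by
  have hle : ∀ (n : ℕ), ∀ z ∈ Set.Ioo (-1 : ℝ) 1, |cutoff n z * f z| ≤ |f z| := by
    intro n z _
    rw [abs_mul]
    exact mul_le_of_le_one_left (abs_nonneg _) (abs_cutoff_le n z)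
  refine tendsto_modePairing k u (fun n => memLp_axis_of_le hf ?_ (hle n)) hf hle fun z hz => ?_
  · exact (isAxisTest_cutoff n).smooth.continuous.measurable.mul hm
  · filter_upwards [eventually_cutoff_eq_one hz] with n hn
    rw [hn, one_mul]

/-- Green's formula between a radial solution of the eigenvalue equation and an arbitrary element
of `H¹_A`. -/
theorem modePairing_green (hF : IsRadial a k F) {l : ℝ}
    (hode : ∀ z ∈ Set.Ioo (-1 : ℝ) 1, HasDerivAt (fun z => (1 - z ^ 2) * deriv F z)
      ((k - a) ^ 2 * (F z / (1 - z ^ 2)) - l * F z) z)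
    (h : HasMagneticGradient a v h₁ h₂) :
    modePairing k (fun z => √(1 - z ^ 2) * deriv F z) h₁ -
      Complex.I * modePairing k (fun z => (k - a) * (F z / √(1 - z ^ 2))) h₂ =
      l * modePairing k F v := by
  have hG : ContDiffOn ℝ ∞ (fun z => (1 - z ^ 2) * deriv F z) (Set.Ioo (-1) 1) :=
    ContDiffOn.mul (by fun_prop) hF.contDiffOn_deriv
  have hQ : ContDiffOn ℝ ∞ (fun z => F z / (1 - z ^ 2)) (Set.Ioo (-1) 1) :=
    hF.smooth.div (by fun_prop) fun z hz => (one_sub_sq_pos hz).ne'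
  have step : ∀ n, modePairing k (fun z => cutoff n z * (√(1 - z ^ 2) * deriv F z)) h₁ -
      Complex.I * modePairing k (fun z => cutoff n z * ((k - a) * (F z / √(1 - z ^ 2)))) h₂ =
      l * modePairing k (fun z => cutoff n z * F z) v -
        modePairing k (fun z => deriv (cutoff n) z * ((1 - z ^ 2) * deriv F z)) v := by
    intro n
    have hc := isAxisTest_cutoff n
    have z1 := h.modePairing_dz k (hc.mul hG)
    -- Testing with χ_n F / (1 - z²) turns the singular potential term into a pairing with h₂.
    have z2 := h.modePairing_dtheta k (hc.mul hQ)
    have e1 : modePairing k (deriv fun z => cutoff n z * ((1 - z ^ 2) * deriv F z)) v =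
        modePairing k (fun z => deriv (cutoff n) z * ((1 - z ^ 2) * deriv F z)) v +
        ((k - a) ^ 2 * modePairing k (fun z => cutoff n z * (F z / (1 - z ^ 2))) v +
          (-l) * modePairing k (fun z => cutoff n z * F z) v) := by
      have c1 := modePairing_const_mul k ((k - a) ^ 2)
        (fun z => cutoff n z * (F z / (1 - z ^ 2))) v
      have c2 := modePairing_const_mul k (-l) (fun z => cutoff n z * F z) v
      push_cast at c1 c2
      have hsum : MemLp (fun z => (k - a) ^ 2 * (cutoff n z * (F z / (1 - z ^ 2))) +
          -l * (cutoff n z * F z)) 2 axisVol :=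
        ((hc.mul hQ).memLp.const_mul _).add ((hc.mul hF.smooth).memLp.const_mul _)
      rw [← c1, ← c2, ← modePairing_add k ((hc.mul hQ).memLp.const_mul _)
        ((hc.mul hF.smooth).memLp.const_mul _), ← modePairing_add k (hc.deriv.mul hG).memLp hsum]
      refine modePairing_congr k (fun z hz => ?_) v
      have d := ((hc.smooth.differentiable (by simp) z).hasDerivAt).mul (hode z hz)
      refine (HasDerivAt.deriv d).trans ?_
      ring
    have e2 : modePairing k (fun z => cutoff n z * ((1 - z ^ 2) * deriv F z) / √(1 - z ^ 2)) h₁ =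
        modePairing k (fun z => cutoff n z * (√(1 - z ^ 2) * deriv F z)) h₁ := by
      refine modePairing_congr k (fun z hz => ?_) h₁
      have hs := Real.sqrt_pos.2 (one_sub_sq_pos hz)
      have hq := Real.sq_sqrt (one_sub_sq_pos hz).le
      rw [div_eq_iff hs.ne']
      linear_combination -(cutoff n z * deriv F z) * hq
    have e3 : ((k - a : ℝ) : ℂ) *
        modePairing k (fun z => √(1 - z ^ 2) * (cutoff n z * (F z / (1 - z ^ 2)))) h₂ =
        modePairing k (fun z => cutoff n z * ((k - a) * (F z / √(1 - z ^ 2)))) h₂ := by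
      rw [← modePairing_const_mul]
      refine modePairing_congr k (fun z hz => ?_) h₂
      have hs := Real.sqrt_pos.2 (one_sub_sq_pos hz)
      have hp := one_sub_sq_pos hz
      have hq := Real.sq_sqrt hp.le
      field_simp
      linear_combination (cutoff n z * F z * (k - a)) * hq
    rw [e1, e2] at z1
    rw [← e3]
    push_cast
    have hI := Complex.I_sq
    linear_combination z1 - Complex.I * (k - a) * z2 -
      (k - a) ^ 2 * modePairing k (fun z => cutoff n z * (F z / (1 - z ^ 2))) v * hI
  have L := ((tendsto_cutoff_mul k h₁ hF.meas_dz hF.memLp_dz).sub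
    ((tendsto_cutoff_mul k h₂ hF.meas_dtheta hF.memLp_dtheta).const_mul Complex.I))
  have R := ((tendsto_cutoff_mul k v hF.meas hF.memLp).const_mul (l : ℂ)).sub
    (hF.tendsto_boundary h)
  rw [sub_zero] at R
  simp only [step] at L
  exact tendsto_nhds_unique L R

/-- The eigenvalue equation in weak form. -/
theorem inner_grad (hF : IsRadial a k F) {l : ℝ}
    (hode : ∀ z ∈ Set.Ioo (-1 : ℝ) 1, HasDerivAt (fun z => (1 - z ^ 2) * deriv F z)
      ((k - a) ^ 2 * (F z / (1 - z ^ 2)) - l * F z) z)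
    (h : HasMagneticGradient a v h₁ h₂) :
    inner ℂ hF.gradZ h₁ + inner ℂ hF.gradTheta h₂ = l * inner ℂ hF.toLp v := by
  have := hF.modePairing_green hode h
  rw [gradZ, gradTheta, toLp, inner_smul_left, inner_modeLp, inner_modeLp, inner_modeLp,
    Complex.conj_I]
  linear_combination (4 * Real.pi : ℂ)⁻¹ * this

end IsRadial

/-! ### Gegenbauer polynomials and explicit eigenfunctions -/

open Polynomial in
/-- Gegenbauer polynomials (up to normalization) of degree `n` for the weight `(1 - x²)^m`, built
by the raising operator. -/
noncomputable def gegenbauer : ℕ → ℝ → ℝ[X]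
  | 0, _ => 1
  | n + 1, m => (1 - X ^ 2) * derivative (gegenbauer n (m + 1)) -
      C (2 * (m + 1)) * X * gegenbauer n (m + 1)

-- The two identities feed each other. Inserting the lowering formula for P_{n+1} into its equation
-- gives back the raising recursion, since both constants equal (n + 1)(n + 2m + 2). Differentiating
-- the raising recursion and using the equation with parameter m + 1 gives the next lowering
-- formula. Since m shifts, the induction is over all m at once.
open Polynomial in
theorem gegenbauer_ode (n : ℕ) : ∀ m : ℝ,
    (1 - X ^ 2) * derivative (derivative (gegenbauer n m)) -
      C (2 * (m + 1)) * X * derivative (gegenbauer n m) +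
      C (n * (n + 2 * m + 1)) * gegenbauer n m = 0 ∧
    derivative (gegenbauer (n + 1) m) =
      -C ((n + 1) * (n + 2 * m + 2)) * gegenbauer n (m + 1) := by
  induction n with
  | zero =>
    intro m
    refine ⟨by simp [gegenbauer], ?_⟩
    simp [gegenbauer]
    ring_nf
  | succ n ih =>
    have hstep : ∀ m : ℝ, (1 - X ^ 2) * derivative (derivative (gegenbauer (n + 1) m)) -
        C (2 * (m + 1)) * X * derivative (gegenbauer (n + 1) m) +
        C (((n + 1 : ℕ) : ℝ) * (((n + 1 : ℕ) : ℝ) + 2 * m + 1)) * gegenbauer (n + 1) m = 0 := by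
      intro m
      rw [(ih m).2, gegenbauer]
      simp only [derivative_mul, derivative_neg, derivative_C]
      simp only [C_mul, C_add, C_1, map_natCast, map_ofNat]
      push_cast
      ring
    intro m
    refine ⟨hstep m, ?_⟩
    have h := hstep (m + 1)
    rw [show gegenbauer (n + 1 + 1) m = (1 - X ^ 2) * derivative (gegenbauer (n + 1) (m + 1)) -
      C (2 * (m + 1)) * X * gegenbauer (n + 1) (m + 1) from rfl]
    simp only [derivative_mul, derivative_sub, derivative_C, derivative_X, derivative_one,
      derivative_X_pow]
    simp only [C_mul, C_add, C_1, map_natCast, map_ofNat] at h ⊢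
    push_cast at h ⊢
    linear_combination h

-- The lowering formula makes the derivative a nonzero multiple of the previous polynomial, so the
-- degree rises by exactly one; m ≥ 0 keeps the constant away from zero.
open Polynomial in
theorem gegenbauer_degree (n : ℕ) : ∀ m : ℝ, 0 ≤ m →
    gegenbauer n m ≠ 0 ∧ (gegenbauer n m).natDegree = n := by
  induction n with
  | zero => intro m _; simp [gegenbauer]
  | succ n ih =>
    intro m hm
    obtain ⟨h0, hd⟩ := ih (m + 1) (by linarith)
    have hder := (gegenbauer_ode n m).2
    have hc : -((n + 1) * (n + 2 * m + 2) : ℝ) ≠ 0 := by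
      have : (0 : ℝ) < (n + 1) * (n + 2 * m + 2) := by positivity
      linarith
    rw [← C_neg] at hder
    have hne : derivative (gegenbauer (n + 1) m) ≠ 0 := by
      rw [hder]; exact mul_ne_zero (C_ne_zero.2 hc) h0
    have hnd : (derivative (gegenbauer (n + 1) m)).natDegree = n := by
      rw [hder, natDegree_C_mul hc, hd]
    have hpos : (gegenbauer (n + 1) m).natDegree ≠ 0 := fun h =>
      hne (derivative_of_natDegree_zero h)
    refine ⟨fun h => hne (by rw [h, derivative_zero]), ?_⟩
    have := natDegree_eq_of_degree_eq_some (degree_derivative hpos)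
    omega

/-- The profile `(1 - z²)^{m/2} P_n(z)` of the eigenfunctions. -/
noncomputable def profile (m : ℝ) (n : ℕ) (z : ℝ) : ℝ :=
  (1 - z ^ 2) ^ (m / 2) * (gegenbauer n m).eval z

theorem hasDerivAt_weight (m : ℝ) {z : ℝ} (hz : z ∈ Set.Ioo (-1 : ℝ) 1) :
    HasDerivAt (fun z : ℝ => (1 - z ^ 2) ^ (m / 2))
      ((1 - z ^ 2) ^ (m / 2) * (-(m * z) / (1 - z ^ 2))) z := by
  have hp := one_sub_sq_pos hz
  have h := ((hasDerivAt_pow 2 z).const_sub 1).rpow_const (p := m / 2) (Or.inl hp.ne')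
  refine h.congr_deriv ?_
  rw [Real.rpow_sub_one hp.ne']
  field_simp
  push_cast
  ring

theorem hasDerivAt_profile (m : ℝ) (n : ℕ) {z : ℝ} (hz : z ∈ Set.Ioo (-1 : ℝ) 1) :
    HasDerivAt (profile m n) ((1 - z ^ 2) ^ (m / 2) * (-(m * z) / (1 - z ^ 2)) *
      (gegenbauer n m).eval z + (1 - z ^ 2) ^ (m / 2) *
      (Polynomial.derivative (gegenbauer n m)).eval z) z :=
  (hasDerivAt_weight m hz).mul ((gegenbauer n m).hasDerivAt z)

/-- The flux (1 - z²) F' is again the weight times a polynomial. This serves both to differentiate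
it once more and to bound the energy near the poles. -/
theorem deriv_profile (m : ℝ) (n : ℕ) {z : ℝ} (hz : z ∈ Set.Ioo (-1 : ℝ) 1) :
    (1 - z ^ 2) * deriv (profile m n) z = (1 - z ^ 2) ^ (m / 2) *
      ((1 - Polynomial.X ^ 2) * Polynomial.derivative (gegenbauer n m) -
        Polynomial.C m * Polynomial.X * gegenbauer n m).eval z := by
  have hp := one_sub_sq_pos hz
  rw [(hasDerivAt_profile m n hz).deriv]
  simp
  field_simp
  ring

/-- The Legendre type equation satisfied by the profiles. -/
theorem profile_ode (m : ℝ) (n : ℕ) {z : ℝ} (hz : z ∈ Set.Ioo (-1 : ℝ) 1) :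
    HasDerivAt (fun z => (1 - z ^ 2) * deriv (profile m n) z)
      (m ^ 2 * (profile m n z / (1 - z ^ 2)) - (n + m) * (n + m + 1) * profile m n z) z := by
  have hp := one_sub_sq_pos hz
  set Q := (1 - Polynomial.X ^ 2) * Polynomial.derivative (gegenbauer n m) -
        Polynomial.C m * Polynomial.X * gegenbauer n m with hQ
  have h := (hasDerivAt_weight m hz).mul (Q.hasDerivAt z)
  have he : (fun z => (1 - z ^ 2) * deriv (profile m n) z) =ᶠ[nhds z]
      fun z => (1 - z ^ 2) ^ (m / 2) * Q.eval z := by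
    filter_upwards [isOpen_Ioo.mem_nhds hz] with y hy
    exact deriv_profile m n hy
  refine (h.congr_of_eventuallyEq he).congr_deriv ?_
  have ode := congrArg (Polynomial.eval z) (gegenbauer_ode n m).1
  simp at ode
  simp [hQ, profile]
  field_simp
  linear_combination (1 - z ^ 2) * ode

theorem measurable_profile (m : ℝ) (n : ℕ) : Measurable (profile m n) := by
  have := (gegenbauer n m).continuous.measurable
  unfold profile
  fun_prop

theorem contDiffOn_profile (m : ℝ) (n : ℕ) : ContDiffOn ℝ ∞ (profile m n) (Set.Ioo (-1) 1) := by
  refine ContDiffOn.mul (ContDiffOn.rpow_const_of_ne (by fun_prop) fun z hz =>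
    (one_sub_sq_pos hz).ne') (Polynomial.contDiff_aeval (gegenbauer n m) _).contDiffOn

/-- For m ≤ 1 the singularity at each pole is bounded by the nearer of (1 - z)^{m-1} and (1 +
z)^{m-1}; for m ≥ 1 the function is at most 1. -/
theorem integrable_one_sub_sq_rpow {m : ℝ} (hm : 0 < m) :
    Integrable (fun z : ℝ => (1 - z ^ 2) ^ (m - 1)) axisVol := by
  have h0 : IntervalIntegrable (fun x : ℝ => x ^ (m - 1)) volume 0 2 :=
    intervalIntegral.intervalIntegrable_rpow' (by linarith)
  have h1 : IntegrableOn (fun z : ℝ => (1 - z) ^ (m - 1)) (Set.Ioo (-1) 1) := by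
    have := (h0.comp_sub_left 1).symm
    rw [show (1 : ℝ) - 2 = -1 by norm_num, sub_zero] at this
    exact (intervalIntegrable_iff_integrableOn_Ioo_of_le (by norm_num)).1 this
  have h2 : IntegrableOn (fun z : ℝ => (1 + z) ^ (m - 1)) (Set.Ioo (-1) 1) := by
    have := h0.comp_add_left 1
    rw [show (2 : ℝ) - 1 = 1 by norm_num, zero_sub] at this
    exact (intervalIntegrable_iff_integrableOn_Ioo_of_le (by norm_num)).1 this
  refine Integrable.mono ((h1.add h2).add (integrable_const (1 : ℝ)))
    (Measurable.aestronglyMeasurable (f := fun z : ℝ => (1 - z ^ 2) ^ (m - 1)) (by fun_prop)) ?_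
  filter_upwards [ae_restrict_mem measurableSet_Ioo] with z hz
  have hp := one_sub_sq_pos hz
  have a1 : 0 < 1 - z := by linarith [hz.2]
  have a2 : 0 < 1 + z := by linarith [hz.1]
  have b1 := Real.rpow_pos_of_pos a1 (m - 1)
  have b2 := Real.rpow_pos_of_pos a2 (m - 1)
  have b3 := Real.rpow_pos_of_pos hp (m - 1)
  simp only [Pi.add_apply]
  rw [Real.norm_of_nonneg b3.le, Real.norm_of_nonneg (by positivity)]
  rcases le_total 1 m with h | h
  · have := Real.rpow_le_one hp.le (by nlinarith [sq_nonneg z]) (by linarith : 0 ≤ m - 1)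
    linarith
  · rcases le_total 0 z with hz0 | hz0
    · have := Real.rpow_le_rpow_of_nonpos a1 (by nlinarith : 1 - z ≤ 1 - z ^ 2)
        (by linarith : m - 1 ≤ 0)
      linarith
    · have := Real.rpow_le_rpow_of_nonpos a2 (by nlinarith : 1 + z ≤ 1 - z ^ 2)
        (by linarith : m - 1 ≤ 0)
      linarith

theorem memLp_weight_div_sqrt {m : ℝ} (hm : 0 < m) :
    MemLp (fun z : ℝ => (1 - z ^ 2) ^ (m / 2) / √(1 - z ^ 2)) 2 axisVol := by
  rw [memLp_two_iff_integrable_sq (Measurable.aestronglyMeasurable (by fun_prop))]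
  refine (integrable_one_sub_sq_rpow hm).congr ?_
  filter_upwards [ae_restrict_mem measurableSet_Ioo] with z hz
  have hp := one_sub_sq_pos hz
  rw [div_pow, Real.sq_sqrt hp.le, ← Real.rpow_mul_natCast hp.le, Real.rpow_sub_one hp.ne']
  congr 2
  push_cast
  ring

theorem memLp_axis_of_continuous {f : ℝ → ℝ} (hf : Continuous f) : MemLp f 2 axisVol := by
  obtain ⟨C, hC⟩ := (isCompact_Icc (a := (-1 : ℝ)) (b := 1)).exists_bound_of_continuousOn
    hf.continuousOn
  refine MemLp.of_bound hf.aestronglyMeasurable C ?_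
  filter_upwards [ae_restrict_mem measurableSet_Ioo] with z hz
  exact hC z (Set.Ioo_subset_Icc_self hz)

theorem memLp_axis_mul_continuous {f g : ℝ → ℝ} (hf : MemLp f 2 axisVol) (hg : Continuous g) :
    MemLp (fun z => f z * g z) 2 axisVol := by
  obtain ⟨C, hC⟩ := (isCompact_Icc (a := (-1 : ℝ)) (b := 1)).exists_bound_of_continuousOn
    hg.continuousOn
  refine (hf.mul_const C).mono (hf.aestronglyMeasurable.mul hg.aestronglyMeasurable) ?_
  filter_upwards [ae_restrict_mem measurableSet_Ioo] with z hz
  rw [norm_mul, norm_mul]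
  exact mul_le_mul_of_nonneg_left
    ((hC z (Set.Ioo_subset_Icc_self hz)).trans (le_abs_self C)) (norm_nonneg _)

theorem memLp_axis_congr {f g : ℝ → ℝ} (hf : MemLp f 2 axisVol)
    (h : ∀ z ∈ Set.Ioo (-1 : ℝ) 1, f z = g z) : MemLp g 2 axisVol := by
  refine hf.ae_eq ?_
  filter_upwards [ae_restrict_mem measurableSet_Ioo] with z hz
  exact h z hz

theorem continuous_profile {m : ℝ} (hm : 0 ≤ m) (n : ℕ) : Continuous (profile m n) :=
  ((Real.continuous_rpow_const (by linarith : 0 ≤ m / 2)).comp (by fun_prop)).mul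
    (gegenbauer n m).continuous

/-- For |k - a| > 0 both gradient components are (1 - z²)^{(|k-a|-1)/2} times a continuous function,
hence square integrable. For k = a the profile is a polynomial on (-1, 1) and the angular component
is zero. -/
theorem isRadial_profile (a : ℝ) (k : ℤ) (n : ℕ) : IsRadial a k (profile |k - a| n) where
  smooth := contDiffOn_profile _ _
  meas := measurable_profile _ _
  memLp := memLp_axis_of_continuous (continuous_profile (abs_nonneg _) n)
  memLp_dz := by
    set m := |(k : ℝ) - a| with hm
    rcases (abs_nonneg ((k : ℝ) - a)).eq_or_lt with h | h
    · rw [← hm] at h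
      refine memLp_axis_congr (f := fun z => √(1 - z ^ 2) *
        (Polynomial.derivative (gegenbauer n m)).eval z) (memLp_axis_of_continuous ?_) ?_
      · have := (Polynomial.derivative (gegenbauer n m)).continuous
        fun_prop
      · intro z hz
        rw [(hasDerivAt_profile m n hz).deriv, ← h]
        simp
    · refine memLp_axis_congr (memLp_axis_mul_continuous (memLp_weight_div_sqrt h)
        ((1 - Polynomial.X ^ 2) * Polynomial.derivative (gegenbauer n m) -
          Polynomial.C m * Polynomial.X * gegenbauer n m).continuous) fun z hz => ?_
      have hs := Real.sqrt_pos.2 (one_sub_sq_pos hz)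
      have hq := Real.sq_sqrt (one_sub_sq_pos hz).le
      rw [div_mul_eq_mul_div, ← hm, ← deriv_profile m n hz, div_eq_iff hs.ne']
      linear_combination -(deriv (profile m n) z) * hq
  memLp_dtheta := by
    rcases (abs_nonneg ((k : ℝ) - a)).eq_or_lt with h | h
    · have : (k : ℝ) - a = 0 := abs_eq_zero.1 h.symm
      simp [this]
    · refine MemLp.const_mul (memLp_axis_congr (memLp_axis_mul_continuous (memLp_weight_div_sqrt h)
        (gegenbauer n |(k : ℝ) - a|).continuous) fun z hz => ?_) _
      rw [profile]
      ring
  memLp_deriv hk := by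
    have h : |(k : ℝ) - a| = 0 := by rw [hk, sub_self, abs_zero]
    rw [h]
    refine memLp_axis_congr (memLp_axis_of_continuous
      (Polynomial.derivative (gegenbauer n 0)).continuous) fun z hz => ?_
    rw [(hasDerivAt_profile 0 n hz).deriv]
    simp

/-- The eigenvalues `(ℓ + |k - a|)(ℓ + |k - a| + 1)`. -/
noncomputable def level (a : ℝ) (j : ℤ × ℕ) : ℝ :=
  (j.2 + |(j.1 : ℝ) - a|) * (j.2 + |(j.1 : ℝ) - a| + 1)

/-- The (unnormalized) eigenfunctions. -/
noncomputable def eigenfun (a : ℝ) (j : ℤ × ℕ) : L2 := (isRadial_profile a j.1 j.2).toLp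

/-- First component of the magnetic gradient of the eigenfunctions. -/
noncomputable def eigenGradZ (a : ℝ) (j : ℤ × ℕ) : L2 := (isRadial_profile a j.1 j.2).gradZ

/-- Second component of the magnetic gradient of the eigenfunctions. -/
noncomputable def eigenGradTheta (a : ℝ) (j : ℤ × ℕ) : L2 := (isRadial_profile a j.1 j.2).gradTheta

theorem hasMagneticGradient_eigenfun (a : ℝ) (j : ℤ × ℕ) :
    HasMagneticGradient a (eigenfun a j) (eigenGradZ a j) (eigenGradTheta a j) :=
  (isRadial_profile a j.1 j.2).hasMagneticGradient

theorem inner_eigenGrad (a : ℝ) (j : ℤ × ℕ) {v h₁ h₂ : L2} (h : HasMagneticGradient a v h₁ h₂) :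
    inner ℂ (eigenGradZ a j) h₁ + inner ℂ (eigenGradTheta a j) h₂ =
      level a j * inner ℂ (eigenfun a j) v := by
  refine (isRadial_profile a j.1 j.2).inner_grad (fun z hz => ?_) h
  rw [← sq_abs ((j.1 : ℝ) - a)]
  exact profile_ode _ j.2 hz

/-! ### Completeness of the eigenfunctions -/

/-- An integrable function on `(-1, 1)` that is orthogonal to all polynomials vanishes. -/
theorem ae_eq_zero_of_forall_polynomial {W : ℝ → ℂ} (hW : Integrable W axisVol)
    (h : ∀ p : Polynomial ℝ, ∫ z in Set.Ioo (-1 : ℝ) 1, p.eval z • W z = 0) :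
    ∀ᵐ z ∂axisVol, W z = 0 := by
  rw [ae_restrict_iff' measurableSet_Ioo]
  refine isOpen_Ioo.ae_eq_zero_of_integral_contDiff_smul_eq_zero
    (IntegrableOn.locallyIntegrableOn hW) fun g hg _ hsupp => ?_
  have hbd : ∀ f : ℝ → ℝ, Continuous f → Integrable (fun z => f z • W z) axisVol := by
    intro f hf
    obtain ⟨C, hC⟩ := (isCompact_Icc (a := (-1 : ℝ)) (b := 1)).exists_bound_of_continuousOn
      hf.continuousOn
    refine hW.bdd_smul C hf.aestronglyMeasurable ?_
    filter_upwards [ae_restrict_mem measurableSet_Ioo] with z hz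
    exact hC z (Set.Ioo_subset_Icc_self hz)
  have hset : ∫ z, g z • W z = ∫ z in Set.Ioo (-1 : ℝ) 1, g z • W z := by
    rw [setIntegral_eq_integral_of_forall_compl_eq_zero]
    intro z hz
    rw [image_eq_zero_of_notMem_tsupport fun hz' => hz (hsupp hz'), zero_smul]
  rw [hset]
  set A := ∫ z in Set.Ioo (-1 : ℝ) 1, ‖W z‖ with hA
  have hA0 : 0 ≤ A := integral_nonneg fun z => norm_nonneg _
  have hle : ∀ ε > 0, ‖∫ z in Set.Ioo (-1 : ℝ) 1, g z • W z‖ ≤ ε * A := by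
    intro ε hε
    obtain ⟨p, hp⟩ := exists_polynomial_near_of_continuousOn (-1) 1 g hg.continuous.continuousOn ε hε
    rw [← sub_zero (∫ z in Set.Ioo (-1 : ℝ) 1, g z • W z), ← h p,
      ← integral_sub (hbd g hg.continuous) (hbd _ p.continuous), hA, ← integral_const_mul]
    refine norm_integral_le_of_norm_le (hW.norm.const_mul ε) ?_
    filter_upwards [ae_restrict_mem measurableSet_Ioo] with z hz
    rw [← sub_smul, norm_smul, Real.norm_eq_abs, abs_sub_comm]
    exact mul_le_mul_of_nonneg_right (hp z (Set.Ioo_subset_Icc_self hz)).le (norm_nonneg _)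
  rw [← norm_le_zero_iff]
  refine le_of_forall_pos_le_add fun δ hδ => ?_
  have h1 := hle (δ / (A + 1)) (by positivity)
  have h2 : δ / (A + 1) * A ≤ δ := by
    rw [div_mul_eq_mul_div, div_le_iff₀ (by positivity)]
    nlinarith
  linarith

/-- The polynomials `gegenbauer n m`, `n = 0, 1, …`, as a sequence with one polynomial in each
degree. -/
noncomputable def gegenbauerSequence (m : ℝ) (hm : 0 ≤ m) : Polynomial.Sequence ℝ where
  elems' n := gegenbauer n m
  degree_eq' n := by
    rw [Polynomial.degree_eq_natDegree (gegenbauer_degree n m hm).1, (gegenbauer_degree n m hm).2]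

theorem memLp_weight_mul_poly {m : ℝ} (hm : 0 ≤ m) (p : Polynomial ℝ) :
    MemLp (fun z => (1 - z ^ 2) ^ (m / 2) * p.eval z) 2 axisVol :=
  memLp_axis_of_continuous <| ((Real.continuous_rpow_const (by linarith : 0 ≤ m / 2)).comp
    (by fun_prop)).mul p.continuous

/-- There is one Gegenbauer polynomial in each degree, so they span all polynomials. -/
theorem modePairing_weight_mul_poly {m : ℝ} (hm : 0 ≤ m) {k : ℤ} {u : L2}
    (h : ∀ n, modePairing k (profile m n) u = 0) (p : Polynomial ℝ) :
    modePairing k (fun z => (1 - z ^ 2) ^ (m / 2) * p.eval z) u = 0 := by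
  have hp : p ∈ Submodule.span ℝ (Set.range (gegenbauerSequence m hm)) := by
    rw [Polynomial.Sequence.span _ fun i => ?_]
    · trivial
    · exact isUnit_iff_ne_zero.2 (Polynomial.leadingCoeff_ne_zero.2
        (gegenbauer_degree i m hm).1)
  induction hp using Submodule.span_induction with
  | mem x hx =>
    obtain ⟨n, rfl⟩ := hx
    exact h n
  | zero => simp [modePairing]
  | add x y _ _ hx hy =>
    have := modePairing_add k (memLp_weight_mul_poly hm x) (memLp_weight_mul_poly hm y) u
    rw [hx, hy, add_zero] at this
    rw [← this]
    congr 1 with z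
    rw [Polynomial.eval_add, mul_add]
  | smul c x _ hx =>
    have := modePairing_const_mul k c (fun z => (1 - z ^ 2) ^ (m / 2) * x.eval z) u
    rw [hx, mul_zero] at this
    rw [← this]
    congr 1 with z
    rw [Polynomial.eval_smul, smul_eq_mul]
    ring

/-- The `k`-th angular Fourier integral of `u`. -/
noncomputable def angularCoeff (k : ℤ) (u : L2) (z : ℝ) : ℂ :=
  ∫ t in Set.Ioo 0 (2 * Real.pi), u (cyl (t, z)) * Complex.exp (-(k * t * Complex.I))

/-- By Fubini the weighted coefficient (1 - z²)^{m/2} û_k(z) is orthogonal to every polynomial,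
hence zero, and the weight does not vanish inside (-1, 1). -/
theorem angularCoeff_ae_eq_zero {m : ℝ} (hm : 0 ≤ m) {k : ℤ} {u : L2}
    (h : ∀ n, modePairing k (profile m n) u = 0) : ∀ᵐ z ∂axisVol, angularCoeff k u z = 0 := by
  have hinner : ∀ (f : ℝ → ℝ) (z : ℝ), ∫ t in Set.Ioo 0 (2 * Real.pi), u (cyl (t, z)) *
      (Complex.exp (-(k * t * Complex.I)) * (f z : ℂ)) = f z • angularCoeff k u z := by
    intro f z
    rw [angularCoeff, Complex.real_smul, ← integral_const_mul]
    congr 1 with t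
    ring
  have hint := integrable_modePairing k (memLp_weight_mul_poly hm 1) u
  have hW : Integrable (fun z : ℝ => (1 - z ^ 2) ^ (m / 2) • angularCoeff k u z) axisVol := by
    rw [rectVol_eq_prod] at hint
    refine hint.integral_prod_right.congr (.of_forall fun z => ?_)
    simp only [hinner fun z => (1 - z ^ 2) ^ (m / 2) * (1 : Polynomial ℝ).eval z]
    simp
  have h0 := ae_eq_zero_of_forall_polynomial hW fun p => by
    have e := modePairing_weight_mul_poly hm h p
    rw [modePairing, integral_rect_eq_theta_last
      (integrable_modePairing k (memLp_weight_mul_poly hm p) u)] at e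
    simp only [hinner fun z => (1 - z ^ 2) ^ (m / 2) * p.eval z] at e
    rw [← e]
    congr 1 with z
    rw [smul_smul, mul_comm]
  filter_upwards [h0, ae_restrict_mem measurableSet_Ioo] with z hz hz'
  exact (smul_eq_zero.1 hz).resolve_left (Real.rpow_pos_of_pos (one_sub_sq_pos hz') _).ne'

/-- Fourier uniqueness on `(0, 2π)`. -/
theorem integral_norm_sq_eq_zero {f : ℝ → ℂ}
    (hf : MemLp f 2 (volume.restrict (Set.Ioo 0 (2 * Real.pi))))
    (h : ∀ k : ℤ, ∫ t in Set.Ioo 0 (2 * Real.pi), f t * Complex.exp (-(k * t * Complex.I)) = 0) :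
    ∫ t in Set.Ioo 0 (2 * Real.pi), ‖f t‖ ^ 2 = 0 := by
  have h2 : (0 : ℝ) < 2 * Real.pi := Real.two_pi_pos
  -- Parseval's identity: all coefficients vanish, hence so does the norm.
  have hs := hasSum_sq_fourierCoeffOn h2 (f := f) (by rwa [← restrict_Ioo_eq_restrict_Ioc])
  have hc : ∀ n, fourierCoeffOn h2 f n = 0 := by
    intro n
    rw [fourierCoeffOn_eq_integral, intervalIntegral.integral_of_le h2.le,
      integral_Ioc_eq_integral_Ioo]
    have : ∫ t in Set.Ioo 0 (2 * Real.pi),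
        fourier (-n) (t : AddCircle (2 * Real.pi - 0)) • f t = 0 := by
      rw [← h n]
      congr 1 with t
      rw [fourier_coe_apply, smul_eq_mul, mul_comm]
      congr 2
      have : (Real.pi : ℂ) ≠ 0 := by exact_mod_cast Real.pi_ne_zero
      push_cast
      rw [sub_zero]
      field_simp
    rw [this, smul_zero]
  simp only [hc, norm_zero, ne_eq, OfNat.ofNat_ne_zero, not_false_eq_true, zero_pow] at hs
  have := hs.unique hasSum_zero
  rw [sub_zero, smul_eq_mul, intervalIntegral.integral_of_le h2.le,
    integral_Ioc_eq_integral_Ioo] at this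
  exact (mul_eq_zero.1 this).resolve_left (inv_ne_zero h2.ne')

/-- The eigenfunctions span a dense subspace. -/
theorem eq_zero_of_inner_eigenfun (a : ℝ) {u : L2} (h : ∀ j, inner ℂ (eigenfun a j) u = 0) :
    u = 0 := by
  have hpi : (4 * Real.pi : ℂ)⁻¹ ≠ 0 := by
    exact_mod_cast inv_ne_zero (by positivity : (4 * Real.pi : ℝ) ≠ 0)
  have hk : ∀ᵐ z ∂axisVol, ∀ k : ℤ, angularCoeff k u z = 0 := by
    refine ae_all_iff.2 fun k => angularCoeff_ae_eq_zero (abs_nonneg ((k : ℝ) - a)) fun n => ?_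
    have := h (k, n)
    rw [eigenfun, IsRadial.toLp, inner_modeLp] at this
    exact (mul_eq_zero.1 this).resolve_left hpi
  -- The representative of u is strongly measurable, so every slice in θ is measurable, not only
  -- almost every one.
  have hsm : StronglyMeasurable fun p => u (cyl p) :=
    (Lp.stronglyMeasurable u).comp_measurable measurable_cyl
  have hi : Integrable (fun p => ‖u (cyl p)‖ ^ 2) rectVol := (memLp_comp_cyl u).integrable_norm_pow
    (by norm_num)
  have hi' := hi
  rw [rectVol_eq_prod] at hi'
  have hslice : ∀ᵐ z ∂axisVol, ∫ t in Set.Ioo 0 (2 * Real.pi), ‖u (cyl (t, z))‖ ^ 2 = 0 := by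
    filter_upwards [hk, hi'.prod_left_ae] with z hz hz'
    refine integral_norm_sq_eq_zero ?_ hz
    exact (memLp_two_iff_integrable_sq_norm
      (hsm.comp_measurable measurable_prodMk_right).aestronglyMeasurable).2 hz'
  have hzero : ∫ p, ‖u (cyl p)‖ ^ 2 ∂rectVol = 0 := by
    rw [rectVol_eq_prod, integral_prod_symm _ hi']
    exact integral_eq_zero_of_ae hslice
  rw [integral_eq_zero_iff_of_nonneg (fun p => sq_nonneg _) hi] at hzero
  refine eq_zero_of_comp_cyl ?_
  filter_upwards [hzero] with p hp
  simpa using hp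

/-! ### Orthogonality and nonvanishing -/

theorem integral_exp_int_mul_I {n : ℤ} (hn : n ≠ 0) :
    ∫ t in Set.Ioo 0 (2 * Real.pi), Complex.exp (n * t * Complex.I) = 0 := by
  have hc : (n * Complex.I : ℂ) ≠ 0 :=
    mul_ne_zero (by exact_mod_cast hn) Complex.I_ne_zero
  rw [← integral_Ioc_eq_integral_Ioo, ← intervalIntegral.integral_of_le Real.two_pi_pos.le]
  have := integral_exp_mul_complex (a := 0) (b := 2 * Real.pi) hc
  rw [show (fun t : ℝ => Complex.exp (n * t * Complex.I)) =
    fun t : ℝ => Complex.exp (n * Complex.I * t) by ext t; ring_nf, this]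
  have h2 : (n * Complex.I * ((2 * Real.pi : ℝ) : ℂ) : ℂ) = n * (2 * Real.pi * Complex.I) := by
    push_cast; ring
  rw [h2, Complex.exp_int_mul_two_pi_mul_I]
  simp

theorem inner_modeLp_of_ne {k k' : ℤ} (hk : k ≠ k') {f g : ℝ → ℝ} (hfm : Measurable f)
    (hf : MemLp f 2 axisVol) (hgm : Measurable g) (hg : MemLp g 2 axisVol) :
    inner ℂ (modeLp k f hfm hf) (modeLp k' g hgm hg) = 0 := by
  rw [inner_modeLp, modePairing]
  have e : ∫ p in rect, modeLp k' g hgm hg (cyl p) *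
      (Complex.exp (-(k * p.1 * Complex.I)) * (f p.2 : ℂ)) =
      ∫ p in rect, Complex.exp ((k' - k : ℤ) * p.1 * Complex.I) * ((g p.2 * f p.2 : ℝ) : ℂ) := by
    refine integral_congr_ae ?_
    filter_upwards [modeLp_cyl_ae_eq k' g hgm hg] with p hp
    rw [hp, show ((k' - k : ℤ) * p.1 * Complex.I : ℂ) =
      k' * p.1 * Complex.I + -(k * p.1 * Complex.I) by push_cast; ring, Complex.exp_add]
    push_cast
    ring
  rw [e, rect, Measure.volume_eq_prod,
    setIntegral_prod_mul (fun t : ℝ => Complex.exp ((k' - k : ℤ) * t * Complex.I))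
      (fun z => ((g z * f z : ℝ) : ℂ)),
    integral_exp_int_mul_I (sub_ne_zero.2 hk.symm), zero_mul, mul_zero]

/-- The exponential and the weight never vanish on the rectangle, and a nonzero polynomial has
finitely many roots, so the zero set is null. -/
theorem eigenfun_ne_zero (a : ℝ) (j : ℤ × ℕ) : eigenfun a j ≠ 0 := by
  intro h
  set m := |(j.1 : ℝ) - a| with hm
  have h1 : ∀ᵐ p ∂rectVol, (gegenbauer j.2 m).eval p.2 = 0 := by
    have h0 : ∀ᵐ p ∂rectVol, eigenfun a j (cyl p) = 0 := by
      rw [h]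
      exact comp_cyl_ae_eq (Lp.coeFn_zero ℂ 2 sigma)
    filter_upwards [h0, modeLp_cyl_ae_eq j.1 _ (isRadial_profile a j.1 j.2).meas
      (isRadial_profile a j.1 j.2).memLp, ae_restrict_mem measurableSet_rect] with p h2 h3 hp
    rw [eigenfun, IsRadial.toLp, h3] at h2
    have h4 := (mul_eq_zero.1 h2).resolve_left (Complex.exp_ne_zero _)
    exact (mul_eq_zero.1 (Complex.ofReal_eq_zero.1 h4)).resolve_left
      (Real.rpow_pos_of_pos (one_sub_sq_pos hp.2) _).ne'
  have hfin : (Set.Ioo (-1 : ℝ) 1 ∩ {z | (gegenbauer j.2 m).eval z = 0}).Finite := by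
    refine ((gegenbauer j.2 m).roots.toFinset.finite_toSet).subset fun z hz => ?_
    simpa [(gegenbauer_degree j.2 m (abs_nonneg _)).1] using hz.2
  have h2 : volume (rect ∩ {p | (gegenbauer j.2 m).eval p.2 = 0}) = 0 := by
    refine measure_mono_null (t := Set.univ ×ˢ
      (Set.Ioo (-1 : ℝ) 1 ∩ {z | (gegenbauer j.2 m).eval z = 0}))
      (fun p hp => ⟨trivial, hp.1.2, hp.2⟩) ?_
    rw [Measure.volume_eq_prod, Measure.prod_prod, hfin.measure_zero, mul_zero]
  rw [ae_restrict_iff' measurableSet_rect] at h1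
  have h3 : volume rect = 0 := by
    refine measure_mono_null (t := (rect ∩ {p | (gegenbauer j.2 m).eval p.2 = 0}) ∪
      {p | ¬(p ∈ rect → (gegenbauer j.2 m).eval p.2 = 0)}) (fun p hp => ?_)
      (measure_union_null h2 h1)
    by_cases hp0 : (gegenbauer j.2 m).eval p.2 = 0
    · exact Or.inl ⟨hp, hp0⟩
    · exact Or.inr fun h => hp0 (h hp)
  rw [volume_rect] at h3
  exact ofReal_four_pi_ne_zero h3

/-! ### The closed graph and the eigenbasis -/

/-- The Hilbert space `L² × L² × L²` containing the graph of the magnetic gradient. -/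
abbrev GraphSpace : Type := WithLp 2 (L2 × WithLp 2 (L2 × L2))

/-- The triple `(u, g₁, g₂)` as an element of the graph space. -/
def triple (u g₁ g₂ : L2) : GraphSpace := WithLp.toLp 2 (u, WithLp.toLp 2 (g₁, g₂))

theorem inner_triple (u g₁ g₂ v h₁ h₂ : L2) :
    inner ℂ (triple u g₁ g₂) (triple v h₁ h₂) =
      inner ℂ u v + (inner ℂ g₁ h₁ + inner ℂ g₂ h₂) := by
  rw [triple, triple, WithLp.prod_inner_apply, WithLp.prod_inner_apply]

/-- The magnetic gradient is a closed linear operator. -/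
theorem exists_closed_graph (a : ℝ) : ∃ G : Submodule ℂ GraphSpace, IsClosed (G : Set GraphSpace) ∧
    ∀ x : GraphSpace, x ∈ G ↔ HasMagneticGradient a x.fst x.snd.fst x.snd.snd := by
  choose A hA using fun φ : {φ // IsTest φ} => exists_clm_integral_rect φ.2.memLp_deriv_snd
  choose B hB using fun φ : {φ // IsTest φ} => exists_clm_integral_rect φ.2.memLp_div_sqrt
  choose C hC using fun φ : {φ // IsTest φ} =>
    exists_clm_integral_rect (φ.2.memLp_magneticDeriv a)
  choose D hD using fun φ : {φ // IsTest φ} => exists_clm_integral_rect φ.2.memLp_sqrt_mul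
  let p0 : GraphSpace →L[ℂ] L2 := WithLp.fstL 2 ℂ _ _
  let p1 : GraphSpace →L[ℂ] L2 := (WithLp.fstL 2 ℂ _ _).comp (WithLp.sndL 2 ℂ _ _)
  let p2 : GraphSpace →L[ℂ] L2 := (WithLp.sndL 2 ℂ _ _).comp (WithLp.sndL 2 ℂ _ _)
  let S : {φ // IsTest φ} → GraphSpace →L[ℂ] ℂ := fun φ => (A φ).comp p0 + (B φ).comp p1
  let T : {φ // IsTest φ} → GraphSpace →L[ℂ] ℂ := fun φ => (C φ).comp p0 + (D φ).comp p2
  refine ⟨⨅ φ, ((S φ).ker ⊓ (T φ).ker), ?_, fun x => ?_⟩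
  · rw [Submodule.coe_iInf]
    exact isClosed_iInter fun φ => (S φ).isClosed_ker.inter (T φ).isClosed_ker
  · rw [Submodule.mem_iInf, hasMagneticGradient_iff, Subtype.forall]
    refine forall₂_congr fun φ hφ => ?_
    rw [← hA ⟨φ, hφ⟩, ← hB ⟨φ, hφ⟩, ← hC ⟨φ, hφ⟩, ← hD ⟨φ, hφ⟩]
    rfl

theorem HasMagneticGradient.smul {a : ℝ} {u g₁ g₂ : L2} (h : HasMagneticGradient a u g₁ g₂)
    (c : ℂ) : HasMagneticGradient a (c • u) (c • g₁) (c • g₂) := by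
  obtain ⟨G, -, hG⟩ := exists_closed_graph a
  exact (hG (c • triple u g₁ g₂)).1 (G.smul_mem c ((hG (triple u g₁ g₂)).2 h))

/-- `-Δ_A + 1` has a right inverse. -/
theorem exists_isNegLaplacian (a : ℝ) (f : L2) : ∃ u : L2, IsNegLaplacian a u (f - u) := by
  obtain ⟨G, hc, hG⟩ := exists_closed_graph a
  have : CompleteSpace G := hc.completeSpace_coe
  let π : G →L[ℂ] L2 := (WithLp.fstL 2 ℂ _ _).comp G.subtypeL
  -- Riesz representation: U is the graph element whose graph inner product with any (v, h₁, h₂) is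
  -- ⟨v, f⟩, that is, the weak solution of (-Δ_A + 1) u = f.
  set U := ContinuousLinearMap.adjoint (𝕜 := ℂ) (E := G) (F := L2) π f with hU
  refine ⟨π U, U.1.snd.fst, U.1.snd.snd, (hG U.1).1 U.2, fun v h₁ h₂ hv => ?_⟩
  have e := ContinuousLinearMap.adjoint_inner_right (𝕜 := ℂ) (E := G) (F := L2) π ⟨triple v h₁ h₂, (hG _).2 hv⟩ f
  rw [← hU, Submodule.coe_inner] at e
  change inner ℂ (triple v h₁ h₂) (triple (π U) U.1.snd.fst U.1.snd.snd) = inner ℂ v f at e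
  rw [inner_triple] at e
  rw [inner_sub_right, ← e]
  ring

/-- A Hilbert basis `b` of eigenfunctions for the eigenvalues `level a`, with magnetic gradients
`(p, q)`. -/
structure IsEigenbasis (a : ℝ) (b : HilbertBasis (ℤ × ℕ) ℂ L2) (p q : ℤ × ℕ → L2) : Prop where
  grad : ∀ j, HasMagneticGradient a (b j) (p j) (q j)
  green : ∀ j v h₁ h₂, HasMagneticGradient a v h₁ h₂ →
    inner ℂ (p j) h₁ + inner ℂ (q j) h₂ = level a j * inner ℂ (b j) v

/-- For equal k, Green's formula read in both orders gives (λ - λ') ⟨e, e'⟩ = 0, and λ is strictly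
increasing in n. Equal eigenvalues for different k do no harm, since the angular integral already
separates the modes. -/
theorem exists_isEigenbasis (a : ℝ) : ∃ (b : HilbertBasis (ℤ × ℕ) ℂ L2) (p q : ℤ × ℕ → L2),
    IsEigenbasis a b p q := by
  let e := eigenfun a
  let c : ℤ × ℕ → ℂ := fun j => ((‖e j‖ : ℂ))⁻¹
  have horth : ∀ i j, i ≠ j → inner ℂ (e i) (e j) = 0 := by
    rintro ⟨k, n⟩ ⟨k', n'⟩ hij
    by_cases hk : k = k'
    · subst hk
      have hn : n ≠ n' := fun h => hij (by rw [h])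
      have h1 := inner_eigenGrad a (k, n) (hasMagneticGradient_eigenfun a (k, n'))
      have h2 := inner_eigenGrad a (k, n') (hasMagneticGradient_eigenfun a (k, n))
      have h3 := congrArg (starRingEnd ℂ) h2
      simp only [map_add, map_mul, inner_conj_symm, Complex.conj_ofReal] at h3
      rw [h1] at h3
      have hl : level a (k, n) ≠ level a (k, n') := by
        have hm := abs_nonneg ((k : ℝ) - a)
        intro h
        simp only [level] at h
        have h4 : ((n : ℝ) - n') * (n + n' + 2 * |(k : ℝ) - a| + 1) = 0 := by
          linear_combination h
        rcases mul_eq_zero.1 h4 with h5 | h5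
        · exact hn (by exact_mod_cast sub_eq_zero.1 h5)
        · have : (0 : ℝ) < n + n' + 2 * |(k : ℝ) - a| + 1 := by positivity
          exact this.ne' h5
      have h6 : ((level a (k, n) : ℂ) - level a (k, n')) * inner ℂ (e (k, n)) (e (k, n')) = 0 := by
        rw [sub_mul, sub_eq_zero]; exact h3
      exact (mul_eq_zero.1 h6).resolve_left (sub_ne_zero.2 (by exact_mod_cast hl))
    · have h1 := isRadial_profile a k n
      have h2 := isRadial_profile a k' n'
      exact inner_modeLp_of_ne hk h1.meas h1.memLp h2.meas h2.memLp
  have hon : Orthonormal ℂ fun j => c j • e j := by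
    refine ⟨fun j => ?_, fun i j hij => ?_⟩
    · have hn : ‖e j‖ ≠ 0 := norm_ne_zero_iff.2 (eigenfun_ne_zero a j)
      rw [norm_smul, norm_inv, Complex.norm_real, norm_norm, inv_mul_cancel₀ hn]
    · simp only [inner_smul_left, inner_smul_right, horth i j hij, mul_zero]
  have htop : (Submodule.span ℂ (Set.range fun j => c j • e j))ᗮ = ⊥ := by
    rw [Submodule.eq_bot_iff]
    intro u hu
    refine eq_zero_of_inner_eigenfun a fun j => ?_
    have h1 := (Submodule.mem_orthogonal _ _).1 hu _ (Submodule.subset_span ⟨j, rfl⟩)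
    have hcj : c j ≠ 0 := by
      have hn : ‖e j‖ ≠ 0 := norm_ne_zero_iff.2 (eigenfun_ne_zero a j)
      exact inv_ne_zero (by exact_mod_cast hn)
    rw [inner_smul_left] at h1
    exact (mul_eq_zero.1 h1).resolve_left ((map_ne_zero _).2 hcj)
  refine ⟨HilbertBasis.mkOfOrthogonalEqBot hon htop, fun j => c j • eigenGradZ a j,
    fun j => c j • eigenGradTheta a j, fun j => ?_, fun j v h₁ h₂ h => ?_⟩
  · rw [HilbertBasis.coe_mkOfOrthogonalEqBot]
    exact (hasMagneticGradient_eigenfun a j).smul (c j)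
  · rw [HilbertBasis.coe_mkOfOrthogonalEqBot]
    simp only [inner_smul_left]
    rw [← mul_add, inner_eigenGrad a j h]
    simp only [e]
    ring

theorem ext_inner_basis {ι : Type*} (b : HilbertBasis ι ℂ L2) {x y : L2}
    (h : ∀ j, inner ℂ (b j) x = inner ℂ (b j) y) : x = y := by
  apply b.repr.injective
  ext j
  rw [b.repr_apply_apply, b.repr_apply_apply, h]

/-- Bounded diagonal operators with respect to a Hilbert basis. -/
theorem exists_diagonal_operator {ι : Type*} (b : HilbertBasis ι ℂ L2) {d : ι → ℂ} {K : ℝ}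
    (hd : ∀ j, ‖d j‖ ≤ K) (hK : 0 ≤ K) :
    ∃ D : L2 →L[ℂ] L2, ∀ x j, inner ℂ (b j) (D x) = d j * inner ℂ (b j) x := by
  let M := lp.mapCLM 2 (fun j : ι => d j • ContinuousLinearMap.id ℂ ℂ) hK fun j => by
    rw [norm_smul, ContinuousLinearMap.norm_id, mul_one]; exact hd j
  let R : L2 →L[ℂ] lp (fun _ : ι => ℂ) 2 := b.repr.toContinuousLinearEquiv.toContinuousLinearMap
  let R' : lp (fun _ : ι => ℂ) 2 →L[ℂ] L2 :=
    b.repr.symm.toContinuousLinearEquiv.toContinuousLinearMap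
  refine ⟨R'.comp (M.comp R), fun x j => ?_⟩
  rw [← b.repr_apply_apply, ← b.repr_apply_apply]
  change b.repr (b.repr.symm (M (b.repr x))) j = _
  rw [LinearIsometryEquiv.apply_symm_apply]
  rfl

/-! ### Resolvent, spectrum and the ground state inequality -/

theorem level_nonneg (a : ℝ) (j : ℤ × ℕ) : 0 ≤ level a j := by
  have := abs_nonneg ((j.1 : ℝ) - a)
  unfold level
  positivity

/-- With t = n + |k - a| ≥ 0, a level t(t + 1) is at least t, so a bound on it confines both n and
k. -/
theorem finite_level_le (a M : ℝ) : {j | level a j ≤ M}.Finite := by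
  refine ((Set.finite_Icc ⌊a - M⌋ ⌈a + M⌉).prod (Set.finite_Iic ⌈M⌉₊)).subset ?_
  rintro ⟨k, n⟩ h
  have hm := abs_nonneg ((k : ℝ) - a)
  have hn : (0 : ℝ) ≤ n := Nat.cast_nonneg n
  simp only [Set.mem_ofPred_eq, level] at h
  have h1 : n + |(k : ℝ) - a| ≤ M := by nlinarith
  have h2 := abs_le.1 (show |(k : ℝ) - a| ≤ M by linarith)
  refine ⟨⟨?_, ?_⟩, ?_⟩
  · have := Int.floor_le (a - M)
    have : ((⌊a - M⌋ : ℤ) : ℝ) ≤ k := by linarith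
    exact_mod_cast this
  · have := Int.le_ceil (a + M)
    have : (k : ℝ) ≤ ((⌈a + M⌉ : ℤ) : ℝ) := by linarith
    exact_mod_cast this
  · have := Nat.le_ceil M
    have : (n : ℝ) ≤ (⌈M⌉₊ : ℝ) := by linarith
    exact_mod_cast this

/-- All but finitely many levels exceed ‖μ‖ + 1 and so lie at distance at least 1 from μ. If μ is
itself a level, the convention 0⁻¹ = 0 keeps the bound true. -/
theorem exists_inv_level_bound (a : ℝ) {μ : ℂ} :
    ∃ K : ℝ, 0 ≤ K ∧ ∀ j, ‖((level a j : ℂ) - μ)⁻¹‖ ≤ K := by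
  have hfin := finite_level_le a (‖μ‖ + 1)
  refine ⟨1 + ∑ j ∈ hfin.toFinset, ‖((level a j : ℂ) - μ)⁻¹‖, by positivity, fun j => ?_⟩
  by_cases hj : j ∈ hfin.toFinset
  · have := Finset.single_le_sum (f := fun j => ‖((level a j : ℂ) - μ)⁻¹‖)
      (fun i _ => norm_nonneg _) hj
    linarith
  · have h0 : 0 ≤ ∑ j ∈ hfin.toFinset, ‖((level a j : ℂ) - μ)⁻¹‖ :=
      Finset.sum_nonneg fun i _ => norm_nonneg _
    have h1 : ‖μ‖ + 1 < level a j := by simpa using hj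
    have h2 : 1 ≤ ‖(level a j : ℂ) - μ‖ := by
      have := norm_sub_norm_le (level a j : ℂ) μ
      rw [Complex.norm_real, Real.norm_of_nonneg (level_nonneg a j)] at this
      linarith
    rw [norm_inv]
    have := inv_le_one_of_one_le₀ h2
    linarith

namespace IsEigenbasis

variable {a : ℝ} {b : HilbertBasis (ℤ × ℕ) ℂ L2} {p q : ℤ × ℕ → L2}

theorem isNegLaplacian (hb : IsEigenbasis a b p q) (j : ℤ × ℕ) : IsNegLaplacian a (b j) ((level a j : ℂ) • b j) := by
  refine ⟨p j, q j, hb.grad j, fun v h₁ h₂ h => ?_⟩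
  have := congrArg (starRingEnd ℂ) (hb.green j v h₁ h₂ h)
  simp only [map_add, map_mul, inner_conj_symm, Complex.conj_ofReal] at this
  rw [this, inner_smul_right]

theorem inner_eq (hb : IsEigenbasis a b p q) {u f : L2} (h : IsNegLaplacian a u f) (j : ℤ × ℕ) :
    inner ℂ (b j) f = level a j * inner ℂ (b j) u := by
  obtain ⟨g₁, g₂, hg, h⟩ := h
  rw [← h _ _ _ (hb.grad j), hb.green j _ _ _ hg]

theorem mem_resolvents (hb : IsEigenbasis a b p q) {μ : ℂ} (hμ : ∀ j, μ ≠ level a j) : μ ∈ resolvents a := by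
  obtain ⟨K, hK, hd⟩ := exists_inv_level_bound a (μ := μ)
  obtain ⟨D, hD⟩ := exists_diagonal_operator b hd hK
  have hne : ∀ j, (level a j : ℂ) - μ ≠ 0 := fun j => sub_ne_zero.2 (hμ j).symm
  refine ⟨D, fun g => ?_, fun u f h => ?_⟩
  -- It must be shown that D g lies in the domain. Solving (-Δ_A + 1) u = g + (μ + 1) D g produces
  -- an element of the domain, and comparing coefficients identifies it with D g.
  · obtain ⟨u, hu⟩ := exists_isNegLaplacian a (g + (μ + 1) • D g)
    have hu' : u = D g := by
      refine ext_inner_basis b fun j => ?_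
      have h1 := hb.inner_eq hu j
      rw [inner_sub_right, inner_add_right, inner_smul_right, hD] at h1
      have h2 : ((level a j : ℂ) + 1) ≠ 0 := by
        have := level_nonneg a j
        exact_mod_cast (by linarith : level a j + 1 ≠ 0)
      rw [hD]
      apply mul_left_cancel₀ h2
      have h3 := mul_inv_cancel₀ (hne j)
      linear_combination -h1 - inner ℂ (b j) g * h3
    rw [hu'] at hu
    convert hu using 1
    rw [add_smul, one_smul]
    abel
  · refine ext_inner_basis b fun j => ?_
    rw [hD, inner_sub_right, inner_smul_right, hb.inner_eq h j, ← sub_mul,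
      inv_mul_cancel_left₀ (hne j)]

theorem mem_eigenvalues_iff (hb : IsEigenbasis a b p q) {μ : ℂ} : μ ∈ eigenvalues a ↔ ∃ j, μ = level a j := by
  constructor
  · rintro ⟨u, hu, h⟩
    by_contra! hμ
    apply hu
    refine ext_inner_basis b fun j => ?_
    have h1 := hb.inner_eq h j
    rw [inner_smul_right] at h1
    have h2 : (μ - level a j) * inner ℂ (b j) u = 0 := by rw [sub_mul, h1, sub_self]
    rw [(mul_eq_zero.1 h2).resolve_left (sub_ne_zero.2 (hμ j)), inner_zero_right]
  · rintro ⟨j, rfl⟩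
    exact ⟨b j, b.orthonormal.ne_zero j, hb.isNegLaplacian j⟩

theorem mem_spectrum_iff (hb : IsEigenbasis a b p q) {μ : ℂ} : μ ∈ laplaceSpectrum a ↔ ∃ j, μ = level a j := by
  constructor
  · intro h
    by_contra! hμ
    exact h (hb.mem_resolvents hμ)
  · rintro ⟨j, rfl⟩ ⟨R, -, hR⟩
    have := hR _ _ (hb.isNegLaplacian j)
    rw [sub_self, map_zero] at this
    exact b.orthonormal.ne_zero j this.symm

/-- The magnetic ground state inequality, from Bessel's inequality in the graph space. -/
theorem mul_norm_sq_le (hb : IsEigenbasis a b p q) {l : ℝ}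
    (hle : ∀ j, l ≤ level a j) {u g₁ g₂ : L2}
    (h : HasMagneticGradient a u g₁ g₂) : l * ‖u‖ ^ 2 ≤ ‖g₁‖ ^ 2 + ‖g₂‖ ^ 2 := by
  -- The graph norm of the j-th basis element, by which it is normalized below.
  let s : ℤ × ℕ → ℝ := fun j => √(1 + level a j)
  have hpos : ∀ j, 0 < 1 + level a j := fun j => by linarith [level_nonneg a j]
  have hs : ∀ j, (s j : ℂ) ≠ 0 := fun j => by exact_mod_cast (Real.sqrt_pos.2 (hpos j)).ne'
  have hsq : ∀ j, (s j : ℂ) ^ 2 = 1 + level a j := fun j => by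
    exact_mod_cast Real.sq_sqrt (hpos j).le
  let E : ℤ × ℕ → GraphSpace := fun j => (s j : ℂ)⁻¹ • triple (b j) (p j) (q j)
  have hE : ∀ j v h₁ h₂, HasMagneticGradient a v h₁ h₂ →
      inner ℂ (E j) (triple v h₁ h₂) = s j * inner ℂ (b j) v := by
    intro j v h₁ h₂ hv
    rw [inner_smul_left, inner_triple, hb.green j v h₁ h₂ hv, map_inv₀, Complex.conj_ofReal,
      ← one_add_mul, ← hsq j]
    have := hs j
    field_simp
  have hon : Orthonormal ℂ E := by
    classical
    rw [orthonormal_iff_ite]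
    intro i j
    rw [show E j = (s j : ℂ)⁻¹ • triple (b j) (p j) (q j) from rfl, inner_smul_right,
      hE i _ _ _ (hb.grad j), orthonormal_iff_ite.1 b.orthonormal i j]
    split_ifs with hij
    · rw [hij, mul_one, inv_mul_cancel₀ (hs j)]
    · simp
  have hU : ‖triple u g₁ g₂‖ ^ 2 = ‖u‖ ^ 2 + (‖g₁‖ ^ 2 + ‖g₂‖ ^ 2) := by
    rw [triple, WithLp.prod_norm_sq_eq_of_L2, WithLp.prod_norm_sq_eq_of_L2]
    rfl
  have hsum : HasSum (fun j => ‖inner ℂ (b j) u‖ ^ 2) (‖u‖ ^ 2) := by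
    have := lp.hasSum_norm (by norm_num) (b.repr u)
    simpa [b.repr_apply_apply] using this
  have hfin : (1 + l) * ‖u‖ ^ 2 ≤ ‖triple u g₁ g₂‖ ^ 2 := by
    refine hasSum_le_of_sum_le (hsum.mul_left (1 + l)) fun t => ?_
    -- Bessel in the graph norm bounds the partial sums of (1 + λ_j) |⟨b_j, u⟩|²; completeness is
    -- needed only in L².
    refine le_trans (Finset.sum_le_sum fun j _ => ?_)
      (hon.sum_inner_products_le (triple u g₁ g₂) (s := t))
    rw [hE j u g₁ g₂ h, norm_mul, mul_pow, Complex.norm_real, Real.norm_eq_abs, sq_abs,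
      Real.sq_sqrt (hpos j).le]
    exact mul_le_mul_of_nonneg_right (by linarith [hle j]) (sq_nonneg _)
  rw [hU] at hfin
  linarith

theorem norm_sq_grad (hb : IsEigenbasis a b p q) (j : ℤ × ℕ) : ‖p j‖ ^ 2 + ‖q j‖ ^ 2 = level a j := by
  have h := hb.green j _ _ _ (hb.grad j)
  rw [inner_self_eq_norm_sq_to_K, inner_self_eq_norm_sq_to_K, inner_self_eq_norm_sq_to_K,
    b.orthonormal.1 j] at h
  simp only [Complex.coe_algebraMap] at h
  have h' : (((‖p j‖ ^ 2 + ‖q j‖ ^ 2 : ℝ)) : ℂ) = (level a j : ℝ) := by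
    push_cast
    rw [h]
    simp
  exact_mod_cast h'

end IsEigenbasis

/-! ### Norms as integrals, and the value of Λ_a -/

theorem integral_norm_sq (u : L2) : ∫ x, ‖u x‖ ^ 2 ∂sigma = ‖u‖ ^ 2 := by
  have h : inner ℂ u u = ∫ x, ((‖u x‖ ^ 2 : ℝ) : ℂ) ∂sigma := by
    rw [L2.inner_def]
    congr 1 with x
    rw [inner_self_eq_norm_sq_to_K]
    simp
  rw [inner_self_eq_norm_sq_to_K, integral_complex_ofReal] at h
  simp only [Complex.coe_algebraMap] at h
  exact_mod_cast h.symm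

theorem integrable_norm_sq (u : L2) : Integrable (fun x => ‖u x‖ ^ 2) sigma :=
  (Lp.memLp u).integrable_norm_pow (by norm_num)

theorem integral_norm_sq_add (g h : L2) :
    ∫ x, (‖g x‖ ^ 2 + ‖h x‖ ^ 2) ∂sigma = ‖g‖ ^ 2 + ‖h‖ ^ 2 := by
  rw [integral_add (integrable_norm_sq g) (integrable_norm_sq h), integral_norm_sq,
    integral_norm_sq]

/-- The map t ↦ t(t + 1) is increasing on t ≥ 0, so the minimum sits at the integer nearest to a. -/
theorem isLeast_groundLevel (a : ℝ) :
    IsLeast (Set.range fun k : ℤ => |(k : ℝ) - a| * (|(k : ℝ) - a| + 1)) (groundLevel a) := by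
  have h : IsLeast (Set.range fun k : ℤ => |(k : ℝ) - a| * (|(k : ℝ) - a| + 1))
      (|(round a : ℝ) - a| * (|(round a : ℝ) - a| + 1)) := by
    refine ⟨⟨round a, rfl⟩, ?_⟩
    rintro _ ⟨k, rfl⟩
    have hk := round_le a k
    rw [abs_sub_comm, abs_sub_comm a] at hk
    have := abs_nonneg ((round a : ℝ) - a)
    simp only
    gcongr
  rw [show groundLevel a = _ from h.csInf_eq]
  exact h

theorem exists_level_eq_groundLevel (a : ℝ) : ∃ j, level a j = groundLevel a := by
  obtain ⟨k, hk⟩ := (isLeast_groundLevel a).1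
  exact ⟨(k, 0), by simpa [level] using hk⟩

theorem groundLevel_le_level (a : ℝ) (j : ℤ × ℕ) : groundLevel a ≤ level a j := by
  refine ((isLeast_groundLevel a).2 ⟨j.1, rfl⟩).trans ?_
  have := abs_nonneg ((j.1 : ℝ) - a)
  have : (0 : ℝ) ≤ j.2 := Nat.cast_nonneg _
  simp only [level]
  gcongr <;> linarith

end MagneticSphere
open MagneticSphere in
theorem lemma2p5 (a : ℝ) :
    -- the minimum defining `Λ_a` is attained
    IsLeast (Set.range fun k : ℤ => |(k : ℝ) - a| * (|(k : ℝ) - a| + 1)) (groundLevel a) ∧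
    -- `Λ_a` is the optimal constant in the magnetic ground state inequality
    IsGreatest
      {C : ℝ | ∀ u g₁ g₂ : L2, HasMagneticGradient a u g₁ g₂ →
        C * ∫ x, ‖u x‖ ^ 2 ∂sigma ≤ ∫ x, (‖g₁ x‖ ^ 2 + ‖g₂ x‖ ^ 2) ∂sigma}
      (groundLevel a) ∧
    -- `Λ_a` is the lowest eigenvalue
    IsLeast {μ : ℝ | (μ : ℂ) ∈ eigenvalues a} (groundLevel a) ∧
    -- the spectrum, which consists of eigenvalues
    laplaceSpectrum a =
      {μ : ℂ | ∃ (l : ℕ) (k : ℤ),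
        μ = (((l + |(k : ℝ) - a|) * (l + |(k : ℝ) - a| + 1) : ℝ) : ℂ)} ∧
    eigenvalues a = laplaceSpectrum a := by
  obtain ⟨b, p, q, hb⟩ := exists_isEigenbasis a
  obtain ⟨j₀, hj₀⟩ := exists_level_eq_groundLevel a
  refine ⟨isLeast_groundLevel a, ⟨?_, ?_⟩, ⟨?_, ?_⟩, ?_, ?_⟩
  · intro u g₁ g₂ h
    rw [integral_norm_sq, integral_norm_sq_add]
    exact hb.mul_norm_sq_le (groundLevel_le_level a) h
  · intro C hC
    -- Sharpness: a normalized lowest eigenfunction has energy exactly Λ_a.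
    have h := hC _ _ _ (hb.grad j₀)
    rwa [integral_norm_sq, integral_norm_sq_add, hb.norm_sq_grad, b.orthonormal.1 j₀,
      one_pow, mul_one, hj₀] at h
  · exact hb.mem_eigenvalues_iff.2 ⟨j₀, by rw [hj₀]⟩
  · intro μ hμ
    obtain ⟨j, hj⟩ := hb.mem_eigenvalues_iff.1 hμ
    rw [Complex.ofReal_inj.1 hj]
    exact groundLevel_le_level a j
  · ext μ
    rw [hb.mem_spectrum_iff]
    exact ⟨fun ⟨j, hj⟩ => ⟨j.2, j.1, hj⟩, fun ⟨l, k, h⟩ => ⟨(k, l), h⟩⟩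
  · ext μ
    rw [hb.mem_spectrum_iff, hb.mem_eigenvalues_iff]
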